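/- Let $n\ge 1$ be an integer, $\alpha>0$, and let $f:[0,\alpha)\to\mathbb R$ be continuous and $n$-convex on $[0,\alpha)$ with $f(0)\le 0$; here $n$-convex means that $$f(\lambda A+(1-\lambda)B)\le \lambda f(A)+(1-\lambda)f(B)$$ for all $\lambda\in[0,1]$ and all self-adjoint complex $n\times n$ matrices $A,B$ whose eigenvalues lie in $[0,\alpha)$. Put $g(t)=f(t)/t$ for $t\in(0,\alpha)$. Then: (1) Let $G:[0,\alpha)\to\mathbb R$ be any function with $G'=g$ on $(0,\alpha)$ (an antiderivative $\int g$ of $g$). At every $t\in[0,\alpha)$ at which $G$ is $2n$ times differentiable (at $t=0$: in the one-sided sense, if the one-sided derivatives exist), the Hankel matrix $$K_n(G;t)=\left(\frac{G^{(i+j)}(t)}{(i+j)!}\right)_{1\le i,j\le n}$$ is positive semidefinite. (2) If $n=2$, then $g$ belongs to the class $Q_2(0,\alpha)$, that is, $g$ is continuously differentiable on $(0,\alpha)$ and, for all $\lambda_1,\lambda_2\in(0,\alpha)$, the Loewner matrix $([\lambda_i,\lambda_j]_g)_{1\le i,j\le 2}$, where $[s,t]_g=\frac{g(s)-g(t)}{s-t}$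 for $s\ne t$ and $[s,s]_g=g'(s)$, is conditionally positive definite: $(x\mid ([\lambda_i,\lambda_j]_g)x)\ge 0$ for every $x=(x_1,x_2)\in\mathbb C^2$ with $x_1+x_2=0$. -/

import Mathlib

open Set Filter Topology
open scoped ComplexOrder

noncomputable section

/-- `f` is `n`-convex (matrix convex of order `n`) on `I`: for all self-adjoint complex `n × n`
matrices `A`, `B` with all eigenvalues in `I` and all `l ∈ [0, 1]`,
`f (l A + (1 - l) B) ≤ l f(A) + (1 - l) f(B)` in the positive semidefinite order.
Here `f(A)` is the functional calculus `cfc f A`. -/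
def MatrixConvexOn (n : ℕ) (I : Set ℝ) (f : ℝ → ℝ) : Prop :=
  ∀ A B : Matrix (Fin n) (Fin n) ℂ, A.IsHermitian → B.IsHermitian →
    spectrum ℝ A ⊆ I → spectrum ℝ B ⊆ I →
    ∀ l ∈ Icc (0 : ℝ) 1,
      ((l • cfc f A + (1 - l) • cfc f B) - cfc f (l • A + (1 - l) • B)).PosSemidef

/-- A complex square matrix is conditionally positive definite (almost positive) if it is
Hermitian and `(x | A x) ≥ 0` for every vector `x` whose entries sum to zero. -/
def CondPosDef {n : ℕ} (A : Matrix (Fin n) (Fin n) ℂ) : Prop :=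
  A.IsHermitian ∧
    ∀ x : Fin n → ℂ, ∑ i, x i = 0 → 0 ≤ (dotProduct (star x) (A.mulVec x)).re

/-- The Loewner matrix `([p i, p j]_h)`, with `[s, s]_h = h' s` and
`[s, t]_h = (h t - h s) / (t - s)` for `s ≠ t` (this is Mathlib's `dslope`). -/
def loewnerMatrix {n : ℕ} (h : ℝ → ℝ) (p : Fin n → ℝ) : Matrix (Fin n) (Fin n) ℂ :=
  Matrix.of fun i j => ((dslope h (p i) (p j) : ℝ) : ℂ)

/-- The class `Q_n(a, b)`: functions that are `C¹` on `(a, b)` and all of whose `n × n` Loewner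
matrices at points of `(a, b)` (not necessarily distinct) are conditionally positive definite. -/
def ClassQ (n : ℕ) (a b : ℝ) : Set (ℝ → ℝ) :=
  {h | ContDiffOn ℝ 1 h (Ioo a b) ∧
    ∀ p : Fin n → ℝ, (∀ i, p i ∈ Ioo a b) → CondPosDef (loewnerMatrix h p)}

/-- `G` is `m` times differentiable at `t` relative to `S` (no continuity of the last derivative is
required): the derivatives of order `< m - 1` are differentiable in `S` near `t`, and the one of
order `m - 1` is differentiable at `t`. -/
def TimesDifferentiableWithinAt (m : ℕ) (G : ℝ → ℝ) (S : Set ℝ) (t : ℝ) : Prop :=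
  ∀ k < m, DifferentiableWithinAt ℝ (iteratedDerivWithin k G S) S t ∧
    (k + 1 < m → ∀ᶠ s in 𝓝[S] t, DifferentiableWithinAt ℝ (iteratedDerivWithin k G S) S s)

/-- The Hankel matrix `K_n(G; t) = (G^{(i+j)}(t) / (i+j)!)`, `1 ≤ i, j ≤ n`, with derivatives
relative to `S`; as `Fin n` counts from `0`, the order `i + j` reads `(i + 1) + (j + 1)`. -/
def hankelK (n : ℕ) (G : ℝ → ℝ) (S : Set ℝ) (t : ℝ) : Matrix (Fin n) (Fin n) ℝ :=
  Matrix.of fun i j =>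
    iteratedDerivWithin ((i.val + 1) + (j.val + 1)) G S t /
      (Nat.factorial ((i.val + 1) + (j.val + 1)) : ℝ)

end

/-! For a smooth `n`-convex `F`, one evaluates `(v | F(ε A) v)` along curves `A = X ± Z(ε)`,
where `X` is the diagonal matrix with nodes `0, 1, …, n - 1`. The second difference of the power
`A ^ m` in the direction `Z` is governed by the moments of the first row of `Z` at the nodes. These
moments are prescribed by inverting a Vandermonde matrix, in such a way that the leading term of the
second difference in `ε` is the Hankel form `∑ x i * x j * F^{(i+j+2)} / (i+j+2)!` of `F`, which is
therefore nonnegative.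

For `g t = F t / t` one has `(t ^ (l + 1) * g^{(l)})' = t ^ l * F^{(l+1)}`. Hence the Hankel form
with entries `t ^ (l + 1) * g^{(l)}` is nondecreasing in `t`. Its limit at `0` is nonnegative,
because `F 0 ≤ 0` and `∑ x i * x j / (i+j+2)` is the integral over `[0, 1]` of a square against
`u du`.

A continuous `f` is a locally uniform limit of smooth `n`-convex functions, so `g = f / t`
satisfies the Hankel inequality in the distributional sense. Where the antiderivative of `g` has a
Peano expansion, testing the inequality against a fixed polynomial bump rescaled towards the point
yields the pointwise inequality.

For `n = 2` the inequality says that `g''' ≥ 0` in the weak sense. Then the increments of `g` are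
convex, hence so is its right derivative, and `g` is `C¹` with convex derivative. The Loewner
condition is the trapezoid inequality `(g q - g p) / (q - p) ≤ (g' p + g' q) / 2`. -/

open scoped Matrix

noncomputable section

section QuadForm

variable {ι : Type*}

lemma isHermitian_real_smul {A : Matrix ι ι ℂ} (hA : A.IsHermitian) (r : ℝ) :
    (r • A).IsHermitian :=
  IsSelfAdjoint.smul (IsSelfAdjoint.all r) hA.isSelfAdjoint

lemma isHermitian_convexCombination {A B : Matrix ι ι ℂ} (hA : A.IsHermitian)
    (hB : B.IsHermitian) (l : ℝ) : (l • A + (1 - l) • B).IsHermitian :=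
  (isHermitian_real_smul hA _).add (isHermitian_real_smul hB _)

variable [Fintype ι]

/-- The real part of the quadratic form `(x | M x)`; for Hermitian `M` it is the whole value. -/
def quadForm (M : Matrix ι ι ℂ) (x : ι → ℂ) : ℝ :=
  (star x ⬝ᵥ M *ᵥ x).re

lemma quadForm_add (M N : Matrix ι ι ℂ) (x : ι → ℂ) :
    quadForm (M + N) x = quadForm M x + quadForm N x := by
  simp [quadForm, Matrix.add_mulVec, dotProduct_add]

lemma quadForm_sub (M N : Matrix ι ι ℂ) (x : ι → ℂ) :
    quadForm (M - N) x = quadForm M x - quadForm N x := by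
  simp [quadForm, Matrix.sub_mulVec, dotProduct_sub]

lemma quadForm_smul (r : ℝ) (M : Matrix ι ι ℂ) (x : ι → ℂ) :
    quadForm (r • M) x = r * quadForm M x := by
  simp [quadForm, Matrix.smul_mulVec, dotProduct_smul]

lemma posSemidef_iff_quadForm {M : Matrix ι ι ℂ} (hM : M.IsHermitian) :
    M.PosSemidef ↔ ∀ x, 0 ≤ quadForm M x := by
  rw [Matrix.posSemidef_iff_dotProduct_mulVec, and_iff_right hM]
  refine forall_congr' fun x => ⟨fun h => (Complex.le_def.1 h).1, fun h => ?_⟩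
  exact Complex.le_def.2 ⟨h, by simpa using (hM.im_star_dotProduct_mulVec_self x).symm⟩

variable [DecidableEq ι]

/-- The weights `|(e_k | x)|²` of a vector `x` in the eigenbasis of a Hermitian matrix. -/
def spectralWeight {A : Matrix ι ι ℂ} (hA : A.IsHermitian) (x : ι → ℂ) (k : ι) : ℝ :=
  ‖((star (hA.eigenvectorUnitary : Matrix ι ι ℂ)) *ᵥ x) k‖ ^ 2

lemma spectralWeight_nonneg {A : Matrix ι ι ℂ} (hA : A.IsHermitian) (x : ι → ℂ) (k : ι) :
    0 ≤ spectralWeight hA x k :=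
  sq_nonneg _

lemma quadForm_cfc (f : ℝ → ℝ) {A : Matrix ι ι ℂ} (hA : A.IsHermitian) (x : ι → ℂ) :
    quadForm (cfc f A) x = ∑ k, f (hA.eigenvalues k) * spectralWeight hA x k := by
  set U : Matrix ι ι ℂ := (hA.eigenvectorUnitary : Matrix ι ι ℂ)
  have hcfc : cfc f A * U = U * Matrix.diagonal (fun k => (f (hA.eigenvalues k) : ℂ)) := by
    rw [hA.cfc_eq f, Matrix.IsHermitian.cfc, Unitary.conjStarAlgAut_apply, Matrix.mul_assoc,
      Unitary.coe_star_mul_self, mul_one]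
    rfl
  have hU : U * star U = 1 := Unitary.coe_mul_star_self hA.eigenvectorUnitary
  have hx : x = U *ᵥ (star U *ᵥ x) := by rw [Matrix.mulVec_mulVec, hU, Matrix.one_mulVec]
  have hstar : star x ᵥ* U = star (star U *ᵥ x) := by
    rw [Matrix.star_mulVec, Matrix.star_eq_conjTranspose, Matrix.conjTranspose_conjTranspose]
  have hmulVec : cfc f A *ᵥ x =
      U *ᵥ (Matrix.diagonal (fun k => (f (hA.eigenvalues k) : ℂ)) *ᵥ (star U *ᵥ x)) := by
    conv_lhs => rw [hx]
    simp only [Matrix.mulVec_mulVec, ← Matrix.mul_assoc, hcfc]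
  rw [quadForm, hmulVec, Matrix.dotProduct_mulVec, hstar, dotProduct, Complex.re_sum]
  refine Finset.sum_congr rfl fun k _ => ?_
  rw [Matrix.mulVec_diagonal, Pi.star_apply, mul_left_comm, Complex.star_def,
    Complex.conj_mul', Complex.re_ofReal_mul, ← Complex.ofReal_pow, Complex.ofReal_re]
  rfl

lemma quadForm_self {A : Matrix ι ι ℂ} (hA : A.IsHermitian) (x : ι → ℂ) :
    quadForm A x = ∑ k, hA.eigenvalues k * spectralWeight hA x k := by
  simpa only [cfc_id ℝ A hA.isSelfAdjoint, id] using quadForm_cfc id hA x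

lemma quadForm_one {A : Matrix ι ι ℂ} (hA : A.IsHermitian) (x : ι → ℂ) :
    quadForm 1 x = ∑ k, spectralWeight hA x k := by
  simpa only [cfc_const_one ℝ A hA.isSelfAdjoint, one_mul] using quadForm_cfc (fun _ => 1) hA x

lemma abs_quadForm_cfc_le {f : ℝ → ℝ} {A : Matrix ι ι ℂ} (hA : A.IsHermitian) {c : ℝ}
    (h : ∀ s ∈ spectrum ℝ A, |f s| ≤ c) (x : ι → ℂ) :
    |quadForm (cfc f A) x| ≤ c * quadForm 1 x := by
  rw [quadForm_cfc f hA, quadForm_one hA, Finset.mul_sum]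
  refine (Finset.abs_sum_le_sum_abs _ _).trans (Finset.sum_le_sum fun k _ => ?_)
  rw [abs_mul, abs_of_nonneg (spectralWeight_nonneg hA x k)]
  exact mul_le_mul_of_nonneg_right (h _ (hA.eigenvalues_mem_spectrum_real k))
    (spectralWeight_nonneg hA x k)

lemma quadForm_mem_of_spectrum_subset {I : Set ℝ} (hI : Convex ℝ I) {A : Matrix ι ι ℂ}
    (hA : A.IsHermitian) (h : spectrum ℝ A ⊆ I) {x : ι → ℂ} (hx : quadForm 1 x = 1) :
    quadForm A x ∈ I := by
  have := hI.sum_mem (fun k _ => spectralWeight_nonneg hA x k) ((quadForm_one hA x).symm.trans hx)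
    fun k _ => h (hA.eigenvalues_mem_spectrum_real k)
  simpa only [quadForm_self hA, smul_eq_mul, mul_comm] using this

lemma exists_quadForm_eq_eigenvalue {A : Matrix ι ι ℂ} (hA : A.IsHermitian) (k : ι) :
    ∃ x, quadForm 1 x = 1 ∧ quadForm A x = hA.eigenvalues k := by
  set v : EuclideanSpace ℂ ι := hA.eigenvectorBasis k
  have hv : quadForm 1 v = 1 := by
    have := hA.eigenvectorBasis.inner_eq_one k
    rw [EuclideanSpace.inner_eq_star_dotProduct, dotProduct_comm] at this
    rw [quadForm, Matrix.one_mulVec, this, Complex.one_re]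
  refine ⟨v, hv, ?_⟩
  have hmul : A = hA.eigenvalues k • (1 : Matrix ι ι ℂ) + (A - hA.eigenvalues k • 1) := by abel
  have hzero : quadForm (A - hA.eigenvalues k • 1) v = 0 := by
    rw [quadForm, Matrix.sub_mulVec, hA.mulVec_eigenvectorBasis k, Matrix.smul_mulVec,
      Matrix.one_mulVec, sub_self, dotProduct_zero, Complex.zero_re]
  conv_lhs => rw [hmul]
  rw [quadForm_add, hzero, quadForm_smul, hv, mul_one, add_zero]

lemma spectrum_convexCombination_subset {I : Set ℝ} (hI : Convex ℝ I) {A B : Matrix ι ι ℂ}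
    (hA : A.IsHermitian) (hB : B.IsHermitian) (sA : spectrum ℝ A ⊆ I) (sB : spectrum ℝ B ⊆ I)
    {l : ℝ} (hl : l ∈ Icc (0 : ℝ) 1) : spectrum ℝ (l • A + (1 - l) • B) ⊆ I := by
  have hC := isHermitian_convexCombination hA hB l
  rw [hC.spectrum_real_eq_range_eigenvalues]
  rintro _ ⟨k, rfl⟩
  obtain ⟨x, hx, hk⟩ := exists_quadForm_eq_eigenvalue hC k
  rw [← hk, quadForm_add, quadForm_smul, quadForm_smul]
  exact hI (quadForm_mem_of_spectrum_subset hI hA sA hx)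
    (quadForm_mem_of_spectrum_subset hI hB sB hx) hl.1 (sub_nonneg.2 hl.2) (by ring)

lemma cfc_comp_add_const (f : ℝ → ℝ) (c : ℝ) {A : Matrix ι ι ℂ} (hA : A.IsHermitian) :
    cfc (fun s => f (s + c)) A = cfc f (A + algebraMap ℝ _ c) := by
  have hfin : ContinuousOn f ((fun s => s + c) '' spectrum ℝ A) :=
    (Matrix.finite_real_spectrum.image _).continuousOn _
  rw [cfc_comp' f (fun s => s + c) A hfin (by fun_prop) hA.isSelfAdjoint,
    cfc_add_const c (fun s => s) A (by fun_prop) hA.isSelfAdjoint, cfc_id' ℝ A hA.isSelfAdjoint]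

lemma isHermitian_add_algebraMap {A : Matrix ι ι ℂ} (hA : A.IsHermitian) (c : ℝ) :
    (A + algebraMap ℝ _ c).IsHermitian :=
  hA.add (IsSelfAdjoint.algebraMap (Matrix ι ι ℂ) (IsSelfAdjoint.all c))

lemma mem_spectrum_add_algebraMap {A : Matrix ι ι ℂ} {c s : ℝ} :
    s ∈ spectrum ℝ (A + algebraMap ℝ _ c) ↔ s - c ∈ spectrum ℝ A := by
  have := spectrum.add_mem_add_iff (R := ℝ) (a := A) (r := s - c) (s := c)
  rwa [sub_add_cancel, add_comm] at this

end QuadForm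

section MatrixConvexOn

variable {n : ℕ} {I : Set ℝ} {f : ℝ → ℝ}

lemma matrixConvexOn_iff_quadForm :
    MatrixConvexOn n I f ↔ ∀ A B : Matrix (Fin n) (Fin n) ℂ, A.IsHermitian → B.IsHermitian →
      spectrum ℝ A ⊆ I → spectrum ℝ B ⊆ I → ∀ l ∈ Icc (0 : ℝ) 1, ∀ x,
        quadForm (cfc f (l • A + (1 - l) • B)) x ≤
          l * quadForm (cfc f A) x + (1 - l) * quadForm (cfc f B) x := by
  refine forall₄_congr fun A B _ _ => forall₄_congr fun _ _ l _ => ?_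
  have hf (C : Matrix (Fin n) (Fin n) ℂ) : (cfc f C).IsHermitian := cfc_predicate f C
  rw [posSemidef_iff_quadForm ((isHermitian_convexCombination (hf A) (hf B) l).sub (hf _))]
  simp only [quadForm_sub, quadForm_add, quadForm_smul, sub_nonneg]

lemma MatrixConvexOn.mono {J : Set ℝ} (h : MatrixConvexOn n I f) (hJ : J ⊆ I) :
    MatrixConvexOn n J f :=
  fun A B hA hB sA sB l hl => h A B hA hB (sA.trans hJ) (sB.trans hJ) l hl

lemma MatrixConvexOn.congr {g : ℝ → ℝ} (h : MatrixConvexOn n I f) (hI : Convex ℝ I)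
    (hfg : EqOn f g I) : MatrixConvexOn n I g := by
  intro A B hA hB sA sB l hl
  rw [← cfc_congr (hfg.mono sA), ← cfc_congr (hfg.mono sB),
    ← cfc_congr (hfg.mono (spectrum_convexCombination_subset hI hA hB sA sB hl))]
  exact h A B hA hB sA sB l hl

lemma MatrixConvexOn.comp_add_const (h : MatrixConvexOn n I f) (c : ℝ) :
    MatrixConvexOn n {s | s + c ∈ I} (fun s => f (s + c)) := by
  intro A B hA hB sA sB l hl
  rw [cfc_comp_add_const f c hA, cfc_comp_add_const f c hB,
    cfc_comp_add_const f c (isHermitian_convexCombination hA hB l)]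
  convert h _ _ (isHermitian_add_algebraMap hA c) (isHermitian_add_algebraMap hB c)
    (fun s hs => by simpa using sA (mem_spectrum_add_algebraMap.1 hs))
    (fun s hs => by simpa using sB (mem_spectrum_add_algebraMap.1 hs)) l hl using 3
  module

lemma MatrixConvexOn.sub_const (h : MatrixConvexOn n I f) (c : ℝ) :
    MatrixConvexOn n I (fun s => f s - c) := by
  have hquad : ∀ {A : Matrix (Fin n) (Fin n) ℂ}, A.IsHermitian → ∀ x,
      quadForm (cfc (fun s => f s - c) A) x = quadForm (cfc f A) x - c * quadForm 1 x := by
    intro A hA x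
    simp only [quadForm_cfc _ hA, quadForm_one hA, Finset.mul_sum, ← Finset.sum_sub_distrib,
      sub_mul]
  rw [matrixConvexOn_iff_quadForm] at h ⊢
  intro A B hA hB sA sB l hl x
  rw [hquad hA, hquad hB, hquad (isHermitian_convexCombination hA hB l)]
  linarith [h A B hA hB sA sB l hl x]

end MatrixConvexOn

section Smoothing

open MeasureTheory ContinuousLinearMap
open scoped Convolution

variable {n : ℕ} {I : Set ℝ} {f : ℝ → ℝ}

lemma MatrixConvexOn.const_mul (h : MatrixConvexOn n I f) {c : ℝ} (hc : 0 ≤ c) :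
    MatrixConvexOn n I (fun s => c * f s) := by
  have hquad : ∀ {A : Matrix (Fin n) (Fin n) ℂ}, A.IsHermitian → ∀ x,
      quadForm (cfc (fun s => c * f s) A) x = c * quadForm (cfc f A) x := by
    intro A hA x
    simp only [quadForm_cfc _ hA, Finset.mul_sum, mul_assoc]
  rw [matrixConvexOn_iff_quadForm] at h ⊢
  intro A B hA hB sA sB l hl x
  rw [hquad hA, hquad hB, hquad (isHermitian_convexCombination hA hB l)]
  linarith [mul_le_mul_of_nonneg_left (h A B hA hB sA sB l hl x) hc]

lemma matrixConvexOn_zero : MatrixConvexOn n I (fun _ => 0) := by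
  intro A B _ _ _ _ l _
  simpa only [cfc_const_zero, smul_zero, add_zero, sub_zero] using Matrix.PosSemidef.zero

variable {Ω : Type*} [MeasurableSpace Ω] {μ : Measure Ω} {g : Ω → ℝ → ℝ}

lemma integrable_quadForm_cfc {ι : Type*} [Fintype ι] [DecidableEq ι]
    (hg : ∀ s, Integrable (fun u => g u s) μ) {A : Matrix ι ι ℂ} (hA : A.IsHermitian)
    (x : ι → ℂ) : Integrable (fun u => quadForm (cfc (g u) A) x) μ := by
  simp only [quadForm_cfc _ hA]
  exact integrable_finsetSum _ fun k _ => (hg _).mul_const _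

lemma quadForm_cfc_integral {ι : Type*} [Fintype ι] [DecidableEq ι]
    (hg : ∀ s, Integrable (fun u => g u s) μ) {A : Matrix ι ι ℂ} (hA : A.IsHermitian)
    (x : ι → ℂ) :
    quadForm (cfc (fun s => ∫ u, g u s ∂μ) A) x = ∫ u, quadForm (cfc (g u) A) x ∂μ := by
  simp only [quadForm_cfc _ hA]
  rw [integral_finsetSum _ fun k _ => (hg _).mul_const _]
  simp only [integral_mul_const]

lemma MatrixConvexOn.integral (hg : ∀ s, Integrable (fun u => g u s) μ)
    (h : ∀ u, MatrixConvexOn n I (g u)) : MatrixConvexOn n I (fun s => ∫ u, g u s ∂μ) := by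
  rw [matrixConvexOn_iff_quadForm]
  intro A B hA hB sA sB l hl x
  have hC := isHermitian_convexCombination hA hB l
  have iA := (integrable_quadForm_cfc hg hA x).const_mul l
  have iB := (integrable_quadForm_cfc hg hB x).const_mul (1 - l)
  rw [quadForm_cfc_integral hg hA, quadForm_cfc_integral hg hB, quadForm_cfc_integral hg hC,
    ← integral_const_mul, ← integral_const_mul, ← integral_add iA iB]
  exact integral_mono (integrable_quadForm_cfc hg hC x) (iA.add iB) fun u =>
    matrixConvexOn_iff_quadForm.1 (h u) A B hA hB sA sB l hl x

lemma MatrixConvexOn.convolution_normed {a b : ℝ} (h : MatrixConvexOn n (Ico a b) f)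
    (hf : Continuous f) (φ : ContDiffBump (0 : ℝ)) :
    MatrixConvexOn n (Ico (a + φ.rOut) (b - φ.rOut))
      (φ.normed volume ⋆[lsmul ℝ ℝ, volume] f) := by
  refine MatrixConvexOn.integral (fun s => ?_) fun u => ?_
  · exact (φ.continuous_normed.smul (hf.comp (by fun_prop))).integrable_of_hasCompactSupport
      φ.hasCompactSupport_normed.smul_right
  · simp only [lsmul_apply, smul_eq_mul]
    rcases eq_or_ne (φ.normed volume u) 0 with hu | hu
    · simpa only [hu, zero_mul] using matrixConvexOn_zero
    have hball : u ∈ Metric.ball (0 : ℝ) φ.rOut := φ.support_normed_eq (μ := volume) ▸ hu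
    rw [Metric.mem_ball, Real.dist_eq, sub_zero, abs_lt] at hball
    refine ((h.comp_add_const (-u)).mono fun s hs => ?_).const_mul (φ.nonneg_normed u)
    exact ⟨by linarith [hs.1], by linarith [hs.2]⟩

lemma exists_uniformContinuous_eqOn_Icc {a b : ℝ} (hab : a ≤ b) (hf : ContinuousOn f (Icc a b)) :
    ∃ g : ℝ → ℝ, UniformContinuous g ∧ EqOn g f (Icc a b) :=
  ⟨IccExtend hab ((Icc a b).domRestrict f),
    (CompactSpace.uniformContinuous_of_continuous hf.domRestrict).comp
      (LipschitzWith.projIcc hab).uniformContinuous,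
    fun _ hs => IccExtend_of_mem hab _ hs⟩

/- Evaluating the mollification at `s + φ.rOut` only uses values of the function to the right of
`s`, so that the left endpoint of the interval of convexity is kept. -/
lemma MatrixConvexOn.exists_smooth_approx {α : ℝ} (hcont : ContinuousOn f (Ico 0 α))
    (hconv : MatrixConvexOn n (Ico 0 α) f) (h0 : f 0 ≤ 0) {β : ℝ} (hβ : 0 ≤ β) (hβα : β < α)
    {ε : ℝ} (hε : 0 < ε) :
    ∃ F : ℝ → ℝ, ContDiff ℝ ((⊤ : ℕ∞) : WithTop ℕ∞) F ∧ MatrixConvexOn n (Ico 0 β) F ∧ F 0 ≤ 0 ∧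
      ∀ s ∈ Icc 0 β, |F s - f s| ≤ ε := by
  obtain ⟨γ, hβγ, hγα⟩ := exists_between hβα
  obtain ⟨g, hg, hgf⟩ := exists_uniformContinuous_eqOn_Icc (hβ.trans hβγ.le)
    (hcont.mono (Icc_subset_Ico_right hγα))
  obtain ⟨δ, hδ, hgδ⟩ := Metric.uniformContinuous_iff.1 hg (ε / 2) (half_pos hε)
  obtain ⟨η, hη, hηlt⟩ := exists_between (lt_min (half_pos hδ) (half_pos (sub_pos.2 hβγ)))
  have hηδ := hηlt.trans_le (min_le_left _ _)
  have hηγ := hηlt.trans_le (min_le_right _ _)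
  let φ : ContDiffBump (0 : ℝ) := ⟨η / 2, η, half_pos hη, half_lt_self hη⟩
  set F : ℝ → ℝ := φ.normed volume ⋆[lsmul ℝ ℝ, volume] g
  have hsmooth : ContDiff ℝ ((⊤ : ℕ∞) : WithTop ℕ∞) F :=
    φ.hasCompactSupport_normed.contDiff_convolution_left _ φ.contDiff_normed
      hg.continuous.locallyIntegrable
  have hFg (s : ℝ) : |F (s + η) - g s| ≤ ε / 2 := by
    refine dist_convolution_le (half_pos hε).le φ.support_normed_eq.subset φ.nonneg_normed
      φ.integral_normed hg.continuous.aestronglyMeasurable fun y hy => (hgδ ?_).le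
    have hy' : |y - (s + η)| < η := hy
    rw [abs_lt] at hy'
    rw [Real.dist_eq, abs_lt]
    constructor <;> linarith
  have hFf : ∀ s ∈ Icc 0 β, |F (s + η) - f s| ≤ ε / 2 := fun s hs =>
    hgf (Icc_subset_Icc_right hβγ.le hs) ▸ hFg s
  refine ⟨fun s => F (s + η) - ε / 2, by fun_prop, ?_, ?_, fun s hs => ?_⟩
  · have hgconv := (hconv.mono (Ico_subset_Ico_right hγα.le)).congr (convex_Ico 0 γ)
      (hgf.symm.mono Ico_subset_Icc_self)
    refine (((hgconv.convolution_normed hg.continuous φ).comp_add_const η).mono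
      fun s hs => ?_).sub_const _
    exact ⟨by simpa [φ] using hs.1, show s + η < γ - η by linarith [hs.2]⟩
  · linarith [(abs_le.1 (hFf 0 ⟨le_rfl, hβ⟩)).2]
  · rw [sub_right_comm]
    exact (abs_sub _ _).trans (by rw [abs_of_pos (half_pos hε)]; linarith [hFf s hs])

end Smoothing

section PowExpansion

open Finset.HasAntidiagonal (antidiagonal)

variable {R : Type*} [Ring R]

/-- The coefficient of `s` in `(X + s Y) ^ m`. -/
def powCoeffOne (X Y : R) : ℕ → R
  | 0 => 0
  | m + 1 => X * powCoeffOne X Y m + Y * X ^ m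

/-- The coefficient of `s ^ 2` in `(X + s Y) ^ m`. -/
def powCoeffTwo (X Y : R) : ℕ → R
  | 0 => 0
  | m + 1 => X * powCoeffTwo X Y m + Y * powCoeffOne X Y m

/-- The quotient by `s ^ 3` of the terms of order at least `3` in `(X + s Y) ^ m`. -/
def powRemainder [Algebra ℝ R] (X Y : R) (s : ℝ) : ℕ → R
  | 0 => 0
  | m + 1 => (X + s • Y) * powRemainder X Y s m + Y * powCoeffTwo X Y m

lemma add_smul_pow [Algebra ℝ R] (X Y : R) (s : ℝ) (m : ℕ) :
    (X + s • Y) ^ m = X ^ m + s • powCoeffOne X Y m + s ^ 2 • powCoeffTwo X Y m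
      + s ^ 3 • powRemainder X Y s m := by
  induction m with
  | zero => simp [powCoeffOne, powCoeffTwo, powRemainder]
  | succ m ih =>
    rw [pow_succ', ih]
    simp only [powCoeffOne, powCoeffTwo, powRemainder, add_mul, mul_add, smul_mul_assoc,
      mul_smul_comm, pow_succ' X m]
    module

lemma powCoeffOne_succ_eq_sum (X Y : R) (m : ℕ) :
    powCoeffOne X Y (m + 1) = ∑ p ∈ antidiagonal m, X ^ p.1 * (Y * X ^ p.2) := by
  induction m with
  | zero => simp [powCoeffOne]
  | succ m ih =>
    rw [powCoeffOne, ih, Finset.Nat.antidiagonal_succ, Finset.sum_cons, Finset.sum_map,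
      Finset.mul_sum, add_comm]
    simp [pow_succ', mul_assoc]

lemma powCoeffTwo_add_two_eq_sum (X Y : R) (m : ℕ) :
    powCoeffTwo X Y (m + 2)
      = ∑ p ∈ antidiagonal m, X ^ p.1 * (Y * powCoeffOne X Y (p.2 + 1)) := by
  induction m with
  | zero => simp [powCoeffTwo, powCoeffOne]
  | succ m ih =>
    rw [powCoeffTwo, ih, Finset.Nat.antidiagonal_succ, Finset.sum_cons, Finset.sum_map,
      Finset.mul_sum, add_comm]
    simp [pow_succ', mul_assoc]

variable [TopologicalSpace R] [IsTopologicalRing R] {X Y : ℝ → R}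

lemma continuous_powCoeffOne (hX : Continuous X) (hY : Continuous Y) (m : ℕ) :
    Continuous fun ε => powCoeffOne (X ε) (Y ε) m := by
  induction m with
  | zero => exact continuous_const
  | succ m ih => exact (hX.mul ih).add (hY.mul (hX.pow m))

lemma continuous_powCoeffTwo (hX : Continuous X) (hY : Continuous Y) (m : ℕ) :
    Continuous fun ε => powCoeffTwo (X ε) (Y ε) m := by
  induction m with
  | zero => exact continuous_const
  | succ m ih => exact (hX.mul ih).add (hY.mul (continuous_powCoeffOne hX hY m))

lemma continuous_powRemainder [Algebra ℝ R] [ContinuousSMul ℝ R] {s : ℝ → ℝ}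
    (hX : Continuous X) (hY : Continuous Y) (hs : Continuous s) (m : ℕ) :
    Continuous fun ε => powRemainder (X ε) (Y ε) (s ε) m := by
  induction m with
  | zero => exact continuous_const
  | succ m ih =>
    exact ((hX.add (hs.smul hY)).mul ih).add (hY.mul (continuous_powCoeffTwo hX hY m))

end PowExpansion

/-- The second difference `g (x + z) + g (x - z) - 2 g x`. -/
def secondDiff {E : Type*} [AddCommGroup E] (g : E → ℝ) (x z : E) : ℝ :=
  g (x + z) + g (x - z) - 2 * g x

section ArrowMatrix

open Finset.HasAntidiagonal (antidiagonal)

variable {k : ℕ}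

/-- The diagonal matrix with the nodes `0, 1, …, k` on its diagonal. -/
def nodeMatrix (k : ℕ) : Matrix (Fin (k + 1)) (Fin (k + 1)) ℝ :=
  Matrix.diagonal fun i => (i : ℝ)

/-- The symmetric matrix with first row `(w 0, δ w 1, …, δ w k)` that vanishes outside the first
row and the first column: the direction in which `nodeMatrix k` is perturbed. -/
def arrowMatrix (δ : ℝ) (w : Fin (k + 1) → ℝ) : Matrix (Fin (k + 1)) (Fin (k + 1)) ℝ :=
  Matrix.of (Fin.cons (Fin.cons (w 0) fun j => δ * w j.succ)
    fun i => Fin.cons (δ * w i.succ) fun _ => 0)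

/-- The vector `(δ, 1, …, 1)`, on which the quadratic forms are evaluated. -/
def testVector (k : ℕ) (δ : ℝ) : Fin (k + 1) → ℝ := Fin.cons δ fun _ => 1

/-- The `a`-th moment of the weights `w` at the nodes `0, 1, …, k`. -/
def nodeMoment (w : Fin (k + 1) → ℝ) (a : ℕ) : ℝ := ∑ i, w i * (i : ℝ) ^ a

lemma isSymm_nodeMatrix (k : ℕ) : (nodeMatrix k).IsSymm := Matrix.isSymm_diagonal _

lemma isSymm_arrowMatrix (δ : ℝ) (w : Fin (k + 1) → ℝ) : (arrowMatrix δ w).IsSymm := by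
  ext i j
  cases i using Fin.cases <;> cases j using Fin.cases <;> simp [arrowMatrix]

lemma continuous_arrowMatrix {δ : ℝ → ℝ} {w : ℝ → Fin (k + 1) → ℝ} (hδ : Continuous δ)
    (hw : Continuous w) : Continuous fun ε => arrowMatrix (δ ε) (w ε) := by
  refine continuous_matrix fun i j => ?_
  cases i using Fin.cases <;> cases j using Fin.cases <;>
    simp only [arrowMatrix, Matrix.of_apply, Fin.cons_zero, Fin.cons_succ] <;> fun_prop

lemma continuous_testVector {δ : ℝ → ℝ} (hδ : Continuous δ) :
    Continuous fun ε => testVector k (δ ε) := by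
  refine continuous_pi fun i => ?_
  cases i using Fin.cases <;>
    simp only [testVector, Fin.cons_zero, Fin.cons_succ] <;> fun_prop

lemma nodeMatrix_pow_mulVec (m : ℕ) (v : Fin (k + 1) → ℝ) (i : Fin (k + 1)) :
    (nodeMatrix k ^ m *ᵥ v) i = (i : ℝ) ^ m * v i := by
  simp [nodeMatrix, Matrix.diagonal_pow, Matrix.mulVec_diagonal]

lemma arrowMatrix_mul_pow_mulVec_zero (δ : ℝ) (w : Fin (k + 1) → ℝ) (m : ℕ) :
    ((arrowMatrix δ w * nodeMatrix k ^ m) *ᵥ testVector k δ) 0 = δ * nodeMoment w m := by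
  rw [← Matrix.mulVec_mulVec, Matrix.mulVec, dotProduct, nodeMoment, Finset.mul_sum]
  refine Finset.sum_congr rfl fun i _ => ?_
  rw [nodeMatrix_pow_mulVec]
  cases i using Fin.cases <;> simp [arrowMatrix, testVector] <;> ring

lemma arrowMatrix_mul_pow_mulVec_succ (δ : ℝ) (w : Fin (k + 1) → ℝ) (m : ℕ) (j : Fin k) :
    ((arrowMatrix δ w * nodeMatrix k ^ m) *ᵥ testVector k δ) j.succ
      = δ ^ 2 * w j.succ * 0 ^ m := by
  rw [← Matrix.mulVec_mulVec, Matrix.mulVec, dotProduct, Fin.sum_univ_succ]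
  simp only [nodeMatrix_pow_mulVec]
  simp [arrowMatrix, testVector]
  ring

lemma sum_antidiagonal_zero_pow_mul (h : ℕ → ℝ) (m : ℕ) :
    ∑ p ∈ antidiagonal m, 0 ^ p.1 * h p.2 = h m := by
  rw [Finset.sum_eq_single (0, m)]
  · simp
  · rintro ⟨a, b⟩ hab hne
    have : a ≠ 0 := by rintro rfl; simp_all
    simp [this]
  · simp

lemma powCoeffOne_mulVec_zero (δ : ℝ) (w : Fin (k + 1) → ℝ) (m : ℕ) :
    (powCoeffOne (nodeMatrix k) (arrowMatrix δ w) (m + 1) *ᵥ testVector k δ) 0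
      = δ * nodeMoment w m := by
  rw [powCoeffOne_succ_eq_sum, Matrix.sum_mulVec, Finset.sum_apply]
  simp only [← Matrix.mulVec_mulVec, nodeMatrix_pow_mulVec]
  simp only [Matrix.mulVec_mulVec, arrowMatrix_mul_pow_mulVec_zero, Fin.val_zero, Nat.cast_zero]
  exact sum_antidiagonal_zero_pow_mul (fun a => δ * nodeMoment w a) m

lemma powCoeffOne_mulVec_succ (δ : ℝ) (w : Fin (k + 1) → ℝ) (m : ℕ) (j : Fin k) :
    (powCoeffOne (nodeMatrix k) (arrowMatrix δ w) (m + 1) *ᵥ testVector k δ) j.succ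
      = δ ^ 2 * w j.succ * (j.succ : ℝ) ^ m := by
  rw [powCoeffOne_succ_eq_sum, Matrix.sum_mulVec, Finset.sum_apply]
  simp only [← Matrix.mulVec_mulVec, nodeMatrix_pow_mulVec]
  simp only [Matrix.mulVec_mulVec, arrowMatrix_mul_pow_mulVec_succ]
  rw [← sum_antidiagonal_zero_pow_mul (fun a => δ ^ 2 * w j.succ * (j.succ : ℝ) ^ a) m,
    ← Finset.Nat.sum_antidiagonal_swap]
  exact Finset.sum_congr rfl fun p _ => by simp only [Prod.fst_swap, Prod.snd_swap]; ring

lemma dotProduct_powCoeffTwo_mulVec (δ : ℝ) (w : Fin (k + 1) → ℝ) (m : ℕ) :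
    testVector k δ ⬝ᵥ powCoeffTwo (nodeMatrix k) (arrowMatrix δ w) (m + 2) *ᵥ testVector k δ
      = δ ^ 2 * ∑ p ∈ antidiagonal m, nodeMoment w p.1 * nodeMoment w p.2
        + δ ^ 4 * ∑ j : Fin k, w j.succ ^ 2 * (j.succ : ℝ) ^ m := by
  set X := nodeMatrix k
  set Y := arrowMatrix δ w
  set v := testVector k δ
  have hsymm (a : ℕ) : (X ^ a * Y)ᵀ = Y * X ^ a := by
    rw [Matrix.transpose_mul, Matrix.transpose_pow, (isSymm_arrowMatrix δ w).eq,
      (isSymm_nodeMatrix k).eq]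
  have hterm (p : ℕ × ℕ) : v ⬝ᵥ (X ^ p.1 * (Y * powCoeffOne X Y (p.2 + 1))) *ᵥ v
      = δ ^ 2 * (nodeMoment w p.1 * nodeMoment w p.2)
        + 0 ^ p.1 * (δ ^ 4 * ∑ j : Fin k, w j.succ ^ 2 * (j.succ : ℝ) ^ p.2) := by
    rw [← mul_assoc, ← Matrix.mulVec_mulVec, Matrix.dotProduct_mulVec, ← Matrix.mulVec_transpose,
      hsymm, dotProduct, Fin.sum_univ_succ, arrowMatrix_mul_pow_mulVec_zero,
      powCoeffOne_mulVec_zero]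
    simp only [X, Y, v, arrowMatrix_mul_pow_mulVec_succ, powCoeffOne_mulVec_succ, Finset.mul_sum]
    exact congrArg₂ (· + ·) (by ring) (Finset.sum_congr rfl fun j _ => by ring)
  simp only [powCoeffTwo_add_two_eq_sum, Matrix.sum_mulVec, dotProduct_sum, hterm,
    Finset.sum_add_distrib, ← Finset.mul_sum]
  rw [sum_antidiagonal_zero_pow_mul fun a => δ ^ 4 * ∑ j : Fin k, w j.succ ^ 2 * (j.succ : ℝ) ^ a]

end ArrowMatrix

section HankelCurve

open Finset.HasAntidiagonal (antidiagonal)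

lemma sum_range_antidiagonal_eq_sum_prod {M : Type*} [AddCommMonoid M] {L n : ℕ}
    (h : ℕ × ℕ → M) (hL : 2 * n ≤ L + 1) (h0 : ∀ p : ℕ × ℕ, n ≤ p.1 ∨ n ≤ p.2 → h p = 0) :
    ∑ l ∈ Finset.range L, ∑ p ∈ antidiagonal l, h p = ∑ p : Fin n × Fin n, h (p.1, p.2) := by
  have hbox : ∑ p : Fin n × Fin n, h (p.1, p.2)
      = ∑ p ∈ Finset.range n ×ˢ Finset.range n, h p := by
    simp only [Fintype.sum_prod_type, Finset.sum_product, Finset.sum_range]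
  have hmaps : ∀ p ∈ Finset.range n ×ˢ Finset.range n, p.1 + p.2 ∈ Finset.range L := by
    intro p hp
    simp only [Finset.mem_product, Finset.mem_range] at hp ⊢
    omega
  rw [hbox, ← Finset.sum_fiberwise_of_maps_to hmaps]
  refine Finset.sum_congr rfl fun l _ => (Finset.sum_subset ?_ ?_).symm
  · intro p hp
    exact Finset.HasAntidiagonal.mem_antidiagonal.2 (Finset.mem_filter.1 hp).2
  · intro p hp hp'
    refine h0 p ?_
    rw [Finset.HasAntidiagonal.mem_antidiagonal] at hp
    simp only [Finset.mem_filter, Finset.mem_product, Finset.mem_range] at hp'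
    omega

lemma secondDiff_dotProduct_pow {ι : Type*} [Fintype ι] [DecidableEq ι] (X Y : Matrix ι ι ℝ)
    (v : ι → ℝ) (s : ℝ) (m : ℕ) :
    secondDiff (fun A => v ⬝ᵥ A ^ m *ᵥ v) X (s • Y)
      = s ^ 2 * (2 * (v ⬝ᵥ powCoeffTwo X Y m *ᵥ v))
        + s ^ 3 * (v ⬝ᵥ (powRemainder X Y s m - powRemainder X Y (-s) m) *ᵥ v) := by
  rw [secondDiff, sub_eq_add_neg X, ← neg_smul, add_smul_pow, add_smul_pow]
  simp only [Matrix.add_mulVec, Matrix.sub_mulVec, Matrix.smul_mulVec, dotProduct_add,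
    dotProduct_sub, dotProduct_smul, smul_eq_mul]
  ring

variable {k : ℕ}

/-- The weights at the nodes `0, 1, …, k` whose `a`-th moment is `ε ^ (k - a) * x a` for `a ≤ k`,
found by inverting a Vandermonde matrix. -/
def nodeWeights (x : Fin (k + 1) → ℝ) (ε : ℝ) : Fin (k + 1) → ℝ :=
  (Matrix.vandermonde fun i : Fin (k + 1) => (i : ℝ))ᵀ⁻¹ *ᵥ fun a => ε ^ (k - a : ℕ) * x a

/-- The quantity `ε ^ (a - k) M_a`, extended to `ε = 0`, where `M_a` is the `a`-th moment of
`nodeWeights x ε`. -/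
def scaledMoment (x : Fin (k + 1) → ℝ) (ε : ℝ) (a : ℕ) : ℝ :=
  if h : a < k + 1 then x ⟨a, h⟩ else ε ^ (a - k) * nodeMoment (nodeWeights x ε) a

/-- The perturbation of `nodeMatrix k`. The powers of `ε` are chosen such that the Hankel form
appears at the order `ε ^ (12 * (k + 1))` of a second difference. -/
def nodePerturbation (x : Fin (k + 1) → ℝ) (ε : ℝ) : Matrix (Fin (k + 1)) (Fin (k + 1)) ℝ :=
  ε ^ (4 * (k + 1)) • arrowMatrix (ε ^ (k + 1)) (nodeWeights x ε)

/-- The coefficient of `ε ^ (12 * (k + 1))` in `ε ^ (l + 2)` times the second difference of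
`A ↦ (v | A ^ (l + 2) v)` at `nodeMatrix k` in the direction `nodePerturbation x ε`. -/
def curveCoeff (x : Fin (k + 1) → ℝ) (l : ℕ) (ε : ℝ) : ℝ :=
  let X := nodeMatrix k
  let Y := arrowMatrix (ε ^ (k + 1)) (nodeWeights x ε)
  let v := testVector k (ε ^ (k + 1))
  2 * ∑ p ∈ antidiagonal l, scaledMoment x ε p.1 * scaledMoment x ε p.2
    + ε ^ (l + 2) * (2 * ∑ j : Fin k, nodeWeights x ε j.succ ^ 2 * (j.succ : ℝ) ^ l
      + v ⬝ᵥ (powRemainder X Y (ε ^ (4 * (k + 1))) (l + 2)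
        - powRemainder X Y (-ε ^ (4 * (k + 1))) (l + 2)) *ᵥ v)

lemma nodeMoment_nodeWeights (x : Fin (k + 1) → ℝ) (ε : ℝ) (a : Fin (k + 1)) :
    nodeMoment (nodeWeights x ε) a = ε ^ (k - a : ℕ) * x a := by
  set V := Matrix.vandermonde fun i : Fin (k + 1) => (i : ℝ)
  have hdet : IsUnit Vᵀ.det := by
    rw [Matrix.det_transpose, isUnit_iff_ne_zero, Matrix.det_vandermonde_ne_zero_iff]
    exact Nat.cast_injective.comp Fin.val_injective
  have hmul : (Vᵀ *ᵥ nodeWeights x ε) a = ε ^ (k - a : ℕ) * x a := by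
    rw [nodeWeights, Matrix.mulVec_mulVec, Matrix.mul_nonsing_inv _ hdet, Matrix.one_mulVec]
  rw [← hmul, nodeMoment, Matrix.mulVec, dotProduct]
  exact Finset.sum_congr rfl fun i _ => mul_comm _ _

lemma continuous_nodeWeights (x : Fin (k + 1) → ℝ) : Continuous (nodeWeights x) :=
  Continuous.matrix_mulVec continuous_const (by fun_prop)

lemma scaledMoment_fin (x : Fin (k + 1) → ℝ) (ε : ℝ) (a : Fin (k + 1)) :
    scaledMoment x ε a = x a :=
  dif_pos a.2

lemma scaledMoment_zero_of_lt (x : Fin (k + 1) → ℝ) {a : ℕ} (ha : k < a) :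
    scaledMoment x 0 a = 0 := by
  rw [scaledMoment, dif_neg (by omega), zero_pow (by omega), zero_mul]

lemma pow_mul_nodeMoment_nodeWeights (x : Fin (k + 1) → ℝ) (ε : ℝ) (a : ℕ) :
    ε ^ a * nodeMoment (nodeWeights x ε) a = ε ^ k * scaledMoment x ε a := by
  by_cases h : a < k + 1
  · have hmoment := nodeMoment_nodeWeights x ε ⟨a, h⟩
    rw [scaledMoment, dif_pos h, show nodeMoment (nodeWeights x ε) a = _ from hmoment, ← mul_assoc,
      ← pow_add, Nat.add_sub_cancel' (Nat.lt_succ_iff.1 h)]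
  · rw [scaledMoment, dif_neg h, ← mul_assoc, ← pow_add, Nat.add_sub_cancel' (by omega)]

lemma continuous_scaledMoment (x : Fin (k + 1) → ℝ) (a : ℕ) :
    Continuous fun ε => scaledMoment x ε a := by
  have hw := continuous_nodeWeights x
  by_cases h : a < k + 1
  · simpa only [scaledMoment, dif_pos h] using continuous_const
  · simp only [scaledMoment, dif_neg h, nodeMoment]
    fun_prop

lemma isSymm_nodePerturbation (x : Fin (k + 1) → ℝ) (ε : ℝ) : (nodePerturbation x ε).IsSymm :=
  (isSymm_arrowMatrix _ _).smul _

lemma continuous_nodePerturbation (x : Fin (k + 1) → ℝ) : Continuous (nodePerturbation x) :=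
  (continuous_pow _).smul (continuous_arrowMatrix (continuous_pow _) (continuous_nodeWeights x))

lemma continuous_curveCoeff (x : Fin (k + 1) → ℝ) (l : ℕ) :
    Continuous fun ε => curveCoeff x l ε := by
  have hw := continuous_nodeWeights x
  have hz := continuous_scaledMoment x
  have hY := continuous_arrowMatrix (continuous_pow (k + 1)) hw
  have hv := continuous_testVector (k := k) (continuous_pow (k + 1))
  have hR (σ : ℝ → ℝ) (hσ : Continuous σ) :=
    continuous_powRemainder (continuous_const (y := nodeMatrix k)) hY hσ (l + 2)
  have hρ := hv.dotProduct (((hR _ (continuous_pow (4 * (k + 1)))).sub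
    (hR _ (continuous_pow (4 * (k + 1))).neg)).matrix_mulVec hv)
  refine Continuous.add ?_ ((continuous_pow _).mul (Continuous.add ?_ hρ)) <;> fun_prop

lemma pow_mul_secondDiff_nodePerturbation (x : Fin (k + 1) → ℝ) (ε : ℝ) (l : ℕ) :
    ε ^ (l + 2) * secondDiff (fun A => testVector k (ε ^ (k + 1)) ⬝ᵥ A ^ (l + 2) *ᵥ
        testVector k (ε ^ (k + 1))) (nodeMatrix k) (nodePerturbation x ε)
      = ε ^ (12 * (k + 1)) * curveCoeff x l ε := by
  have hmoments : ε ^ l * ∑ p ∈ antidiagonal l,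
        nodeMoment (nodeWeights x ε) p.1 * nodeMoment (nodeWeights x ε) p.2
      = ε ^ (2 * k) * ∑ p ∈ antidiagonal l, scaledMoment x ε p.1 * scaledMoment x ε p.2 := by
    rw [Finset.mul_sum, Finset.mul_sum]
    refine Finset.sum_congr rfl fun p hp => ?_
    rw [← Finset.HasAntidiagonal.mem_antidiagonal.1 hp, pow_add, mul_mul_mul_comm,
      pow_mul_nodeMoment_nodeWeights, pow_mul_nodeMoment_nodeWeights]
    ring
  rw [nodePerturbation, secondDiff_dotProduct_pow, dotProduct_powCoeffTwo_mulVec]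
  simp only [curveCoeff]
  linear_combination 2 * ε ^ (10 * k + 12) * hmoments

lemma secondDiff_dotProduct_pow_zero_one {ι : Type*} [Fintype ι] [DecidableEq ι]
    (X Z : Matrix ι ι ℝ) (v : ι → ℝ) {m : ℕ} (hm : m < 2) :
    secondDiff (fun A => v ⬝ᵥ A ^ m *ᵥ v) X Z = 0 := by
  rw [← one_smul ℝ Z, secondDiff_dotProduct_pow]
  interval_cases m <;> simp [powCoeffTwo, powCoeffOne, powRemainder]

lemma sum_pow_mul_secondDiff_nodePerturbation (x : Fin (k + 1) → ℝ) (c : ℕ → ℝ) (L : ℕ) (ε : ℝ) :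
    ∑ m ∈ Finset.range (L + 2), c m * (ε ^ m * secondDiff (fun A =>
        testVector k (ε ^ (k + 1)) ⬝ᵥ A ^ m *ᵥ testVector k (ε ^ (k + 1)))
          (nodeMatrix k) (nodePerturbation x ε))
      = ε ^ (12 * (k + 1)) * ∑ l ∈ Finset.range L, c (l + 2) * curveCoeff x l ε := by
  rw [Finset.sum_range_succ', Finset.sum_range_succ', Finset.mul_sum]
  simp only [add_assoc, one_add_one_eq_two, zero_add, pow_mul_secondDiff_nodePerturbation,
    secondDiff_dotProduct_pow_zero_one _ _ _ zero_lt_two,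
    secondDiff_dotProduct_pow_zero_one _ _ _ one_lt_two, mul_zero, add_zero]
  exact Finset.sum_congr rfl fun l _ => mul_left_comm _ _ _

lemma sum_mul_curveCoeff_zero (x : Fin (k + 1) → ℝ) (c : ℕ → ℝ) {L : ℕ} (hL : 2 * k < L) :
    ∑ l ∈ Finset.range L, c (l + 2) * curveCoeff x l 0
      = 2 * ∑ p : Fin (k + 1) × Fin (k + 1), x p.1 * x p.2 * c (p.1 + p.2 + 2) := by
  have hsum := sum_range_antidiagonal_eq_sum_prod (L := L) (n := k + 1)
    (fun p => scaledMoment x 0 p.1 * scaledMoment x 0 p.2 * c (p.1 + p.2 + 2)) (by omega) (by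
      rintro p (h | h)
      · simp only [scaledMoment_zero_of_lt x h, zero_mul]
      · simp only [scaledMoment_zero_of_lt x h, zero_mul, mul_zero])
  simp only [scaledMoment_fin] at hsum
  rw [← hsum, Finset.mul_sum]
  refine Finset.sum_congr rfl fun l _ => ?_
  rw [curveCoeff, zero_pow (by omega), zero_mul, add_zero, mul_left_comm, Finset.mul_sum]
  refine congrArg _ (Finset.sum_congr rfl fun p hp => ?_)
  rw [Finset.HasAntidiagonal.mem_antidiagonal.1 hp, mul_comm]

end HankelCurve

open Asymptotics

section SpectralAsymptotics

lemma exists_eventually_spectrum_smul_le {R : Type*} [NormedRing R] [NormedAlgebra ℝ R]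
    [CompleteSpace R] {M : ℝ → R} (hM : ContinuousAt M 0) :
    ∃ K, 0 ≤ K ∧ ∀ᶠ ε in 𝓝 0, ∀ s ∈ spectrum ℝ (ε • M ε), |s| ≤ K * |ε| := by
  refine ⟨(‖M 0‖ + 1) * ‖(1 : R)‖, by positivity, ?_⟩
  filter_upwards [hM.norm.eventually_le_const (lt_add_one ‖M 0‖)] with ε hε s hs
  calc |s| ≤ ‖ε • M ε‖ * ‖(1 : R)‖ := spectrum.norm_le_norm_mul_of_mem hs
    _ = ‖M ε‖ * ‖(1 : R)‖ * |ε| := by rw [norm_smul, Real.norm_eq_abs]; ring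
    _ ≤ (‖M 0‖ + 1) * ‖(1 : R)‖ * |ε| := by gcongr

open scoped Matrix.Norms.Operator

variable {ι : Type*} [Fintype ι] [DecidableEq ι]

lemma eventually_forall_mem_spectrum_smul {M : ℝ → Matrix ι ι ℂ} (hM : ContinuousAt M 0)
    {p : ℝ → Prop} (hp : ∀ᶠ u in 𝓝 0, p u) :
    ∀ᶠ ε in 𝓝 0, ∀ s ∈ spectrum ℝ (ε • M ε), p s := by
  obtain ⟨K, -, hK⟩ := exists_eventually_spectrum_smul_le hM
  obtain ⟨ρ, hρ, hball⟩ := Metric.eventually_nhds_iff.1 hp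
  have hsmall : ∀ᶠ ε : ℝ in 𝓝 0, K * |ε| < ρ :=
    (Continuous.tendsto' (by fun_prop) 0 0 (by simp)).eventually_lt_const hρ
  filter_upwards [hK, hsmall] with ε hε hερ s hs
  exact hball (by simpa using (hε s hs).trans_lt hερ)

lemma isLittleO_quadForm_cfc {M : ℝ → Matrix ι ι ℂ} (hM : ContinuousAt M 0)
    (hherm : ∀ ε, (M ε).IsHermitian) {v : ℝ → ι → ℂ} (hv : ContinuousAt v 0) {r : ℝ → ℝ} {N : ℕ}
    (hr : r =o[𝓝 0] fun u => u ^ N) :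
    (fun ε => quadForm (cfc r (ε • M ε)) (v ε)) =o[𝓝 0] fun ε => ε ^ N := by
  obtain ⟨K, hK0, hK⟩ := exists_eventually_spectrum_smul_le hM
  have hnorm : ContinuousAt (fun ε => quadForm 1 (v ε)) 0 := by
    simp only [quadForm, Matrix.one_mulVec]
    exact Complex.continuous_re.continuousAt.comp
      (Continuous.continuousAt (by fun_prop : Continuous fun y : ι → ℂ => star y ⬝ᵥ y) |>.comp hv)
  set V := |quadForm 1 (v 0)| + 1
  have hV : ∀ᶠ ε in 𝓝 0, quadForm 1 (v ε) ≤ V :=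
    hnorm.eventually_le_const ((le_abs_self _).trans_lt (lt_add_one _))
  refine IsLittleO.of_bound fun κ hκ => ?_
  set κ' := κ / (K ^ N * V + 1)
  have hκ' : κ' * (K ^ N * V) ≤ κ := by
    rw [div_mul_eq_mul_div, div_le_iff₀ (by positivity)]
    linarith
  filter_upwards [hK, hV,
    eventually_forall_mem_spectrum_smul hM (hr.bound (show 0 < κ' by positivity))]
    with ε hKε hVε hrε
  have hbound : ∀ s ∈ spectrum ℝ (ε • M ε), |r s| ≤ κ' * (K * |ε|) ^ N := fun s hs =>
    calc |r s| ≤ κ' * |s| ^ N := by simpa using hrε s hs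
      _ ≤ κ' * (K * |ε|) ^ N := by gcongr; exact hKε s hs
  calc |quadForm (cfc r (ε • M ε)) (v ε)|
      ≤ κ' * (K * |ε|) ^ N * quadForm 1 (v ε) :=
        abs_quadForm_cfc_le (isHermitian_real_smul (hherm ε) ε) hbound _
    _ ≤ κ' * (K * |ε|) ^ N * V := by gcongr
    _ = κ' * (K ^ N * V) * |ε| ^ N := by ring
    _ ≤ κ * |ε| ^ N := by gcongr
    _ = κ * ‖ε ^ N‖ := by rw [norm_pow, Real.norm_eq_abs]

lemma isLittleO_secondDiff_quadForm_cfc {X Z : ℝ → Matrix ι ι ℂ} (hX : ContinuousAt X 0)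
    (hZ : ContinuousAt Z 0) (hXherm : ∀ ε, (X ε).IsHermitian) (hZherm : ∀ ε, (Z ε).IsHermitian)
    {v : ℝ → ι → ℂ} (hv : ContinuousAt v 0) {r : ℝ → ℝ} {N : ℕ}
    (hr : r =o[𝓝 0] fun u => u ^ N) :
    (fun ε => secondDiff (fun A => quadForm (cfc r A) (v ε)) (ε • X ε) (ε • Z ε))
      =o[𝓝 0] fun ε => ε ^ N := by
  simp only [secondDiff, ← smul_add, ← smul_sub]
  exact ((isLittleO_quadForm_cfc (hX.add hZ) (fun ε => (hXherm ε).add (hZherm ε)) hv hr).add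
    (isLittleO_quadForm_cfc (hX.sub hZ) (fun ε => (hXherm ε).sub (hZherm ε)) hv hr)).sub
    ((isLittleO_quadForm_cfc hX hXherm hv hr).const_mul_left 2)

end SpectralAsymptotics

section Complexify

variable {ι : Type*} [Fintype ι] [DecidableEq ι]

/-- A real matrix regarded as a complex matrix. -/
def complexify : Matrix ι ι ℝ →ₐ[ℝ] Matrix ι ι ℂ := Complex.ofRealAm.mapMatrix

lemma isHermitian_complexify {M : Matrix ι ι ℝ} (hM : M.IsSymm) : (complexify M).IsHermitian := by
  ext i j
  simpa [complexify] using hM.apply i j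

lemma continuous_complexify : Continuous (complexify : Matrix ι ι ℝ → Matrix ι ι ℂ) :=
  continuous_id.matrix_map Complex.continuous_ofReal

lemma quadForm_complexify (M : Matrix ι ι ℝ) (v : ι → ℝ) :
    quadForm (complexify M) (fun i => (v i : ℂ)) = v ⬝ᵥ M *ᵥ v := by
  simp [quadForm, complexify, dotProduct, Matrix.mulVec]

lemma quadForm_cfc_sum_add (L : ℕ) (c : ℕ → ℝ) (r : ℝ → ℝ) {A : Matrix ι ι ℂ}
    (hA : A.IsHermitian) (x : ι → ℂ) :
    quadForm (cfc (fun u => ∑ m ∈ Finset.range L, c m * u ^ m + r u) A) x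
      = ∑ m ∈ Finset.range L, c m * quadForm (A ^ m) x + quadForm (cfc r A) x := by
  have hpow (m : ℕ) : quadForm (A ^ m) x
      = ∑ k, hA.eigenvalues k ^ m * spectralWeight hA x k := by
    rw [← cfc_pow_id (R := ℝ) A m hA.isSelfAdjoint, quadForm_cfc _ hA]
  simp only [hpow, quadForm_cfc _ hA, add_mul, Finset.sum_add_distrib, Finset.sum_mul,
    Finset.mul_sum, mul_assoc]
  rw [Finset.sum_comm]

lemma secondDiff_quadForm_cfc_sum_add (L : ℕ) (c : ℕ → ℝ) (r : ℝ → ℝ) {X Z : Matrix ι ι ℝ}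
    (hX : X.IsSymm) (hZ : Z.IsSymm) (ε : ℝ) (v : ι → ℝ) :
    secondDiff (fun A => quadForm (cfc (fun u => ∑ m ∈ Finset.range L, c m * u ^ m + r u) A)
        fun i => (v i : ℂ)) (ε • complexify X) (ε • complexify Z)
      = ∑ m ∈ Finset.range L, c m * (ε ^ m * secondDiff (fun A => v ⬝ᵥ A ^ m *ᵥ v) X Z)
        + secondDiff (fun A => quadForm (cfc r A) fun i => (v i : ℂ))
          (ε • complexify X) (ε • complexify Z) := by
  have hform {M : Matrix ι ι ℝ} (hM : M.IsSymm) :=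
    quadForm_cfc_sum_add L c r (isHermitian_real_smul (isHermitian_complexify hM) ε)
      fun i => (v i : ℂ)
  simp only [smul_pow, quadForm_smul, ← map_pow, quadForm_complexify] at hform
  simp only [secondDiff, ← smul_add, ← smul_sub, ← map_add, ← map_sub, hform (hX.add hZ),
    hform (hX.sub hZ), hform hX, mul_add, mul_sub, Finset.sum_add_distrib, Finset.sum_sub_distrib,
    mul_left_comm _ (2 : ℝ), ← Finset.mul_sum]
  ring

end Complexify

section HankelForm

/-- The quadratic form of a Hankel matrix `(G^{(i+j)} / (i+j)!)`, `1 ≤ i, j ≤ n`, where `d l`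
stands for `G^{(l+1)}`. -/
def hankelForm {n : ℕ} (d : ℕ → ℝ) (x : Fin n → ℝ) : ℝ :=
  ∑ p : Fin n × Fin n, x p.1 * x p.2 * (d (p.1 + p.2 + 1) / (p.1 + p.2 + 2 : ℕ).factorial)

variable {n : ℕ} {I : Set ℝ} {F : ℝ → ℝ}

lemma MatrixConvexOn.secondDiff_nonneg (h : MatrixConvexOn n I F)
    {A Z : Matrix (Fin n) (Fin n) ℂ} (hA : A.IsHermitian) (hZ : Z.IsHermitian)
    (hadd : spectrum ℝ (A + Z) ⊆ I) (hsub : spectrum ℝ (A - Z) ⊆ I) (x : Fin n → ℂ) :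
    0 ≤ secondDiff (fun B => quadForm (cfc F B) x) A Z := by
  have hmid := matrixConvexOn_iff_quadForm.1 h _ _ (hA.add hZ) (hA.sub hZ) hadd hsub (1 / 2)
    (by norm_num) x
  rw [show (1 / 2 : ℝ) • (A + Z) + (1 - 1 / 2 : ℝ) • (A - Z) = A by module] at hmid
  rw [secondDiff]
  linarith

lemma MatrixConvexOn.eventually_secondDiff_nonneg (h : MatrixConvexOn n I F) (hI : I ∈ 𝓝 0)
    {X Z : ℝ → Matrix (Fin n) (Fin n) ℂ} (hX : ContinuousAt X 0) (hZ : ContinuousAt Z 0)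
    (hXherm : ∀ ε, (X ε).IsHermitian) (hZherm : ∀ ε, (Z ε).IsHermitian) (v : ℝ → Fin n → ℂ) :
    ∀ᶠ ε in 𝓝 0, 0 ≤ secondDiff (fun A => quadForm (cfc F A) (v ε)) (ε • X ε) (ε • Z ε) := by
  filter_upwards [eventually_forall_mem_spectrum_smul (hX.add hZ) hI,
    eventually_forall_mem_spectrum_smul (hX.sub hZ) hI] with ε hadd hsub
  exact h.secondDiff_nonneg (isHermitian_real_smul (hXherm ε) ε)
    (isHermitian_real_smul (hZherm ε) ε) (by rw [← smul_add]; exact hadd)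
    (by rw [← smul_sub]; exact hsub) (v ε)

lemma secondDiff_nodePerturbation_isLittleO {k : ℕ} {c : ℕ → ℝ}
    (hc : (fun u => F u - ∑ m ∈ Finset.range (12 * (k + 1) + 1), c m * u ^ m)
      =o[𝓝 0] fun u => u ^ (12 * (k + 1))) (x : Fin (k + 1) → ℝ) :
    (fun ε => secondDiff (fun A => quadForm (cfc F A)
        fun i => (testVector k (ε ^ (k + 1)) i : ℂ)) (ε • complexify (nodeMatrix k))
          (ε • complexify (nodePerturbation x ε))
        - ε ^ (12 * (k + 1)) * ∑ l ∈ Finset.range (12 * k + 11), c (l + 2) * curveCoeff x l ε)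
      =o[𝓝 0] fun ε => ε ^ (12 * (k + 1)) := by
  set r : ℝ → ℝ := fun u => F u - ∑ m ∈ Finset.range (12 * (k + 1) + 1), c m * u ^ m
  have hF : F = fun u => ∑ m ∈ Finset.range (12 * (k + 1) + 1), c m * u ^ m + r u := by simp [r]
  have hv : Continuous fun ε i => (testVector k (ε ^ (k + 1)) i : ℂ) :=
    continuous_pi fun i => Complex.continuous_ofReal.comp
      ((continuous_apply i).comp (continuous_testVector (continuous_pow _)))
  have hr := isLittleO_secondDiff_quadForm_cfc
    (continuousAt_const (y := complexify (nodeMatrix k)))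
    (continuous_complexify.comp (continuous_nodePerturbation x)).continuousAt
    (fun _ => isHermitian_complexify (isSymm_nodeMatrix k))
    (fun ε => isHermitian_complexify (isSymm_nodePerturbation x ε)) hv.continuousAt hc
  refine hr.congr_left fun ε => ?_
  rw [hF, secondDiff_quadForm_cfc_sum_add _ _ _ (isSymm_nodeMatrix k)
    (isSymm_nodePerturbation x ε), ← sum_pow_mul_secondDiff_nodePerturbation]
  exact (add_sub_cancel_left _ _).symm

theorem MatrixConvexOn.hankel_nonneg_of_isLittleO (h : MatrixConvexOn n I F) {t : ℝ}
    (hI : I ∈ 𝓝 t) {c : ℕ → ℝ} (hc : (fun u => F (u + t) - ∑ m ∈ Finset.range (12 * n + 1),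
      c m * u ^ m) =o[𝓝 0] fun u => u ^ (12 * n)) (x : Fin n → ℝ) :
    0 ≤ ∑ p : Fin n × Fin n, x p.1 * x p.2 * c (p.1 + p.2 + 2) := by
  obtain _ | k := n
  · simp
  set Ψ : ℝ → ℝ := fun ε => ∑ l ∈ Finset.range (12 * k + 11), c (l + 2) * curveCoeff x l ε
  have hΨ : Continuous Ψ :=
    continuous_finsetSum _ fun l _ => (continuous_curveCoeff x l).const_mul _
  have hI0 : {u | u + t ∈ I} ∈ 𝓝 (0 : ℝ) :=
    (Continuous.tendsto' (by fun_prop) 0 t (zero_add t)).eventually hI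
  have hnonneg := (h.comp_add_const t).eventually_secondDiff_nonneg hI0
    (continuousAt_const (y := complexify (nodeMatrix k)))
    (continuous_complexify.comp (continuous_nodePerturbation x)).continuousAt
    (fun _ => isHermitian_complexify (isSymm_nodeMatrix k))
    (fun ε => isHermitian_complexify (isSymm_nodePerturbation x ε))
    fun ε i => (testVector k (ε ^ (k + 1)) i : ℂ)
  have hlim := ((hΨ.tendsto 0).add
    (secondDiff_nodePerturbation_isLittleO hc x).tendsto_div_nhds_zero).mono_left
    (nhdsWithin_le_nhds (s := {0}ᶜ))
  have hΨ0 : 0 ≤ Ψ 0 + 0 := by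
    refine ge_of_tendsto hlim ?_
    filter_upwards [self_mem_nhdsWithin, nhdsWithin_le_nhds hnonneg] with ε hε hsecond
    have hpos : 0 < ε ^ (12 * (k + 1)) := Even.pow_pos (by grind) hε
    rw [sub_div, mul_div_cancel_left₀ _ hpos.ne', add_sub_cancel]
    exact div_nonneg hsecond hpos.le
  simp only [Ψ, sum_mul_curveCoeff_zero x c (show 2 * k < 12 * k + 11 by omega), add_zero] at hΨ0
  linarith

lemma isLittleO_sub_sum_iteratedDeriv (N : ℕ) (hF : ContDiff ℝ N F) (t : ℝ) :
    (fun u => F (u + t) - ∑ m ∈ Finset.range (N + 1),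
      iteratedDeriv m F t / m.factorial * u ^ m) =o[𝓝 0] fun u => u ^ N := by
  have hshift : Tendsto (fun u : ℝ => u + t) (𝓝 0) (𝓝 t) := by
    simpa using (continuous_add_const t).tendsto 0
  have htaylor := (taylor_isLittleO_univ (x₀ := t) hF).comp_tendsto hshift
  simp only [Function.comp_def, taylor_within_apply, iteratedDerivWithin_univ, add_sub_cancel_right,
    smul_eq_mul] at htaylor
  refine htaylor.congr_left fun u => ?_
  simp only [div_eq_inv_mul, mul_right_comm]

theorem MatrixConvexOn.hankelForm_iteratedDeriv_nonneg (h : MatrixConvexOn n I F) {t : ℝ}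
    (hI : I ∈ 𝓝 t) (hF : ContDiff ℝ (12 * n : ℕ) F) (x : Fin n → ℝ) :
    0 ≤ hankelForm (fun l => iteratedDeriv (l + 1) F t) x :=
  h.hankel_nonneg_of_isLittleO hI (isLittleO_sub_sum_iteratedDeriv _ hF t) x

end HankelForm

section HankelFormCalculus

variable {n : ℕ}

lemma hankelForm_const_mul (a : ℝ) (d : ℕ → ℝ) (x : Fin n → ℝ) :
    hankelForm (fun l => a * d l) x = a * hankelForm d x := by
  simp only [hankelForm, Finset.mul_sum]
  exact Finset.sum_congr rfl fun p _ => by ring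

lemma hankelForm_pow_mul (s : ℝ) (d : ℕ → ℝ) (x : Fin n → ℝ) :
    hankelForm (fun l => s ^ l * d l) x = s * hankelForm d fun i => s ^ (i : ℕ) * x i := by
  simp only [hankelForm, Finset.mul_sum]
  exact Finset.sum_congr rfl fun p _ => by ring

lemma hankelForm_pow_succ_mul (s : ℝ) (d : ℕ → ℝ) (x : Fin n → ℝ) :
    hankelForm (fun l => s ^ (l + 1) * d l) x
      = s ^ 2 * hankelForm d fun i => s ^ (i : ℕ) * x i := by
  simp only [pow_succ', mul_assoc, hankelForm_const_mul, hankelForm_pow_mul, pow_zero, mul_one]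

lemma tendsto_hankelForm {X : Type*} {φ : Filter X} {d : ℕ → X → ℝ} {c : ℕ → ℝ}
    (hd : ∀ l, Tendsto (d l) φ (𝓝 (c l))) (x : Fin n → ℝ) :
    Tendsto (fun s => hankelForm (fun l => d l s) x) φ (𝓝 (hankelForm c x)) :=
  tendsto_finsetSum _ fun _ _ => ((hd _).div_const _).const_mul _

lemma hasDerivAt_hankelForm {d : ℕ → ℝ → ℝ} {d' : ℕ → ℝ} {t : ℝ}
    (hd : ∀ l, HasDerivAt (d l) (d' l) t) (x : Fin n → ℝ) :
    HasDerivAt (fun s => hankelForm (fun l => d l s) x) (hankelForm d' x) t :=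
  HasDerivAt.fun_sum fun _ _ => ((hd _).div_const _).const_mul _

lemma hankelForm_factorial_eq_integral (x : Fin n → ℝ) :
    hankelForm (fun l => (l.factorial : ℝ)) x
      = ∫ u in (0 : ℝ)..1, u * (∑ i, x i * u ^ (i : ℕ)) ^ 2 := by
  have hexpand (u : ℝ) : u * (∑ i, x i * u ^ (i : ℕ)) ^ 2
      = ∑ p : Fin n × Fin n, x p.1 * x p.2 * u ^ (p.1 + p.2 + 1 : ℕ) := by
    rw [sq, Finset.sum_mul_sum, ← Fintype.sum_prod_type', Finset.mul_sum]
    exact Finset.sum_congr rfl fun p _ => by ring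
  simp only [hexpand, hankelForm]
  rw [intervalIntegral.integral_finsetSum fun p _ =>
    (by fun_prop : Continuous _).intervalIntegrable _ _]
  refine Finset.sum_congr rfl fun p _ => ?_
  rw [intervalIntegral.integral_const_mul, integral_pow,
    show ((p.1 + p.2 + 2 : ℕ).factorial : ℝ)
      = (p.1 + p.2 + 1 + 1 : ℕ) * (p.1 + p.2 + 1 : ℕ).factorial by
        exact_mod_cast Nat.factorial_succ (p.1 + p.2 + 1),
    div_mul_cancel_right₀ (Nat.cast_ne_zero.2 (Nat.factorial_ne_zero _))]
  simp

lemma hankelForm_factorial_nonneg (x : Fin n → ℝ) :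
    0 ≤ hankelForm (fun l => (l.factorial : ℝ)) x := by
  rw [hankelForm_factorial_eq_integral]
  exact intervalIntegral.integral_nonneg zero_le_one fun u hu => mul_nonneg hu.1 (sq_nonneg _)

end HankelFormCalculus

section Quotient

/-- The derivatives of `t ↦ F t / t` on `t ≠ 0`, expressed through those of `F`. -/
def quotDeriv (F : ℝ → ℝ) : ℕ → ℝ → ℝ
  | 0 => fun t => F t / t
  | l + 1 => fun t => (iteratedDeriv (l + 1) F t - (l + 1) * quotDeriv F l t) / t

variable {F : ℝ → ℝ} (hF : ContDiff ℝ ((⊤ : ℕ∞) : WithTop ℕ∞) F)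
include hF

lemma hasDerivAt_iteratedDeriv (l : ℕ) (t : ℝ) :
    HasDerivAt (iteratedDeriv l F) (iteratedDeriv (l + 1) F t) t := by
  rw [iteratedDeriv_succ]
  exact (hF.differentiable_iteratedDeriv l (by exact_mod_cast ENat.natCast_lt_top l) t).hasDerivAt

lemma hasDerivAt_quotDeriv (l : ℕ) {t : ℝ} (ht : t ≠ 0) :
    HasDerivAt (quotDeriv F l) (quotDeriv F (l + 1) t) t := by
  induction l with
  | zero =>
    have hF0 := hasDerivAt_iteratedDeriv hF 0 t
    rw [iteratedDeriv_zero] at hF0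
    refine (hF0.fun_div (hasDerivAt_id' t) ht).congr_deriv ?_
    simp only [quotDeriv]
    push_cast
    field_simp
    ring
  | succ l ih =>
    refine (((hasDerivAt_iteratedDeriv hF (l + 1) t).fun_sub
      (ih.const_mul ((l : ℝ) + 1))).fun_div (hasDerivAt_id' t) ht).congr_deriv ?_
    simp only [quotDeriv]
    push_cast
    field_simp
    ring

lemma hasDerivAt_pow_mul_quotDeriv (l : ℕ) {t : ℝ} (ht : t ≠ 0) :
    HasDerivAt (fun t => t ^ (l + 1) * quotDeriv F l t) (t ^ l * iteratedDeriv (l + 1) F t) t := by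
  refine ((hasDerivAt_pow (l + 1) t).fun_mul (hasDerivAt_quotDeriv hF l ht)).congr_deriv ?_
  simp only [quotDeriv, Nat.add_sub_cancel]
  push_cast
  field_simp
  ring

lemma tendsto_pow_mul_quotDeriv (l : ℕ) :
    Tendsto (fun t => t ^ (l + 1) * quotDeriv F l t) (𝓝[>] 0)
      (𝓝 ((-1) ^ l * (-(-F 0 * l.factorial)))) := by
  induction l with
  | zero =>
    have hF0 : Tendsto F (𝓝[>] 0) (𝓝 (F 0)) :=
      (hF.continuous.tendsto 0).mono_left nhdsWithin_le_nhds
    simp only [pow_zero, Nat.factorial_zero, Nat.cast_one, one_mul, mul_one, neg_neg, zero_add,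
      pow_one, quotDeriv]
    refine hF0.congr' ?_
    filter_upwards [self_mem_nhdsWithin] with t ht
    exact (mul_div_cancel₀ _ (mem_Ioi.1 ht).ne').symm
  | succ l ih =>
    have hvanish : Tendsto (fun t : ℝ => t ^ (l + 1) * iteratedDeriv (l + 1) F t) (𝓝[>] 0)
        (𝓝 0) := by
      have hcont : Continuous fun t : ℝ => t ^ (l + 1) * iteratedDeriv (l + 1) F t :=
        (continuous_pow _).mul (hF.continuous_iteratedDeriv (l + 1) (by exact_mod_cast le_top))
      simpa using (hcont.tendsto 0).mono_left (nhdsWithin_le_nhds (s := Ioi 0))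
    have hlim := hvanish.sub (ih.const_mul ((l : ℝ) + 1))
    rw [show (0 : ℝ) - (l + 1) * ((-1) ^ l * (-(-F 0 * l.factorial)))
        = (-1) ^ (l + 1) * (-(-F 0 * (l + 1).factorial)) by
      rw [Nat.factorial_succ]; push_cast; ring] at hlim
    refine hlim.congr' ?_
    filter_upwards [self_mem_nhdsWithin] with t ht
    have ht0 : t ≠ 0 := (mem_Ioi.1 ht).ne'
    simp only [quotDeriv]
    field_simp
    ring

variable {n : ℕ} {β : ℝ}

lemma monotoneOn_hankelForm_pow_mul_quotDeriv
    (hH : ∀ t ∈ Ioo 0 β, ∀ x : Fin n → ℝ, 0 ≤ hankelForm (fun l => iteratedDeriv (l + 1) F t) x)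
    (x : Fin n → ℝ) :
    MonotoneOn (fun s => hankelForm (fun l => s ^ (l + 1) * quotDeriv F l s) x) (Ioo 0 β) := by
  have hderiv (s : ℝ) (hs : s ∈ Ioo 0 β) :=
    hasDerivAt_hankelForm (fun l => hasDerivAt_pow_mul_quotDeriv hF l hs.1.ne') x
  refine monotoneOn_of_hasDerivWithinAt_nonneg (convex_Ioo 0 β)
    (fun s hs => (hderiv s hs).continuousAt.continuousWithinAt)
    (fun s hs => (hderiv s (interior_subset hs)).hasDerivWithinAt) fun s hs => ?_
  rw [interior_Ioo] at hs
  rw [hankelForm_pow_mul]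
  exact mul_nonneg hs.1.le (hH s hs _)

theorem hankelForm_quotDeriv_nonneg (h0 : F 0 ≤ 0)
    (hH : ∀ t ∈ Ioo 0 β, ∀ x : Fin n → ℝ, 0 ≤ hankelForm (fun l => iteratedDeriv (l + 1) F t) x)
    {t : ℝ} (ht : t ∈ Ioo 0 β) (x : Fin n → ℝ) :
    0 ≤ hankelForm (fun l => quotDeriv F l t) x := by
  have hscaled (y : Fin n → ℝ) :
      0 ≤ hankelForm (fun l => t ^ (l + 1) * quotDeriv F l t) y := by
    have hlim := tendsto_hankelForm (fun l => tendsto_pow_mul_quotDeriv hF l) y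
    simp only [hankelForm_pow_mul, neg_mul_eq_neg_mul _ (Nat.cast _), neg_neg,
      hankelForm_const_mul] at hlim
    refine le_trans ?_ (le_of_tendsto hlim ?_)
    · nlinarith [hankelForm_factorial_nonneg fun i => (-1) ^ (i : ℕ) * y i]
    · filter_upwards [Ioo_mem_nhdsGT ht.1] with s hs
      exact monotoneOn_hankelForm_pow_mul_quotDeriv hF hH y ⟨hs.1, hs.2.trans ht.2⟩ ht hs.2.le
  have hx : (fun i : Fin n => t ^ (i : ℕ) * (x i / t ^ (i : ℕ))) = x :=
    funext fun i => mul_div_cancel₀ _ (pow_pos ht.1 _).ne'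
  have := hscaled fun i => x i / t ^ (i : ℕ)
  rw [hankelForm_pow_succ_mul, hx] at this
  exact nonneg_of_mul_nonneg_right this (pow_pos ht.1 2)

end Quotient

section JetLimits

/-- `a l` is the `l`-th derivative of `a 0` at every point of `S`. -/
def IsJetOn (a : ℕ → ℝ → ℝ) (S : Set ℝ) : Prop :=
  ∀ l, ∀ s ∈ S, HasDerivAt (a l) (a (l + 1) s) s

/-- `g` is on `S` a uniform limit of smooth functions whose derivatives at every point of `S`, as a
sequence indexed by the order, satisfy `P`. -/
def IsUniformLimitOfJets (P : (ℕ → ℝ) → Prop) (g : ℝ → ℝ) (S : Set ℝ) : Prop :=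
  ∃ a : ℕ → ℕ → ℝ → ℝ, (∀ k, IsJetOn (a k) S) ∧ (∀ k, ∀ s ∈ S, P fun l => a k l s) ∧
    TendstoUniformlyOn (fun k => a k 0) g atTop S

variable {P Q : (ℕ → ℝ) → Prop} {a : ℕ → ℝ → ℝ} {g : ℝ → ℝ} {S T : Set ℝ}

lemma IsJetOn.continuousOn (h : IsJetOn a S) (l : ℕ) : ContinuousOn (a l) S :=
  fun s hs => (h l s hs).continuousAt.continuousWithinAt

lemma IsJetOn.rescale (h : IsJetOn a S) {t ε : ℝ} (hT : MapsTo (fun u => t + ε * u) T S) :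
    IsJetOn (fun l u => ε ^ l * a l (t + ε * u)) T := by
  intro l u hu
  have hinner : HasDerivAt (fun u => t + ε * u) ε u := by
    simpa using ((hasDerivAt_id' u).const_mul ε).const_add t
  exact (((h l _ (hT hu)).comp u hinner).const_mul (ε ^ l)).congr_deriv (by ring)

lemma isJetOn_iterate_derivative (p : Polynomial ℝ) (S : Set ℝ) :
    IsJetOn (fun l s => (Polynomial.derivative^[l] p).eval s) S := by
  intro l s _
  simp only [Function.iterate_succ_apply']
  exact Polynomial.hasDerivAt _ s

lemma IsUniformLimitOfJets.mono (h : IsUniformLimitOfJets P g S) (hPQ : ∀ d, P d → Q d) :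
    IsUniformLimitOfJets Q g S := by
  obtain ⟨a, ha, hP, hlim⟩ := h
  exact ⟨a, ha, fun k s hs => hPQ _ (hP k s hs), hlim⟩

lemma IsUniformLimitOfJets.congr {g' : ℝ → ℝ} (h : IsUniformLimitOfJets P g S)
    (hg : EqOn g g' S) : IsUniformLimitOfJets P g' S := by
  obtain ⟨a, ha, hP, hlim⟩ := h
  exact ⟨a, ha, hP, hlim.congr_right hg⟩

lemma IsUniformLimitOfJets.continuousOn (h : IsUniformLimitOfJets P g S) : ContinuousOn g S := by
  obtain ⟨a, ha, -, hlim⟩ := h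
  exact hlim.continuousOn (.of_forall fun k => (ha k).continuousOn 0)

lemma IsUniformLimitOfJets.rescale (h : IsUniformLimitOfJets P g S) {t ε : ℝ} (hε : ε ≠ 0)
    (hT : MapsTo (fun u => t + ε * u) T S) :
    IsUniformLimitOfJets (fun d => P fun l => d l / ε ^ l) (fun u => g (t + ε * u)) T := by
  obtain ⟨a, ha, hP, hlim⟩ := h
  refine ⟨fun k l u => ε ^ l * a k l (t + ε * u), fun k => (ha k).rescale hT, fun k u hu => ?_, ?_⟩
  · simpa only [mul_div_cancel_left₀ _ (pow_ne_zero _ hε)] using hP k _ (hT hu)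
  · simpa only [pow_zero, one_mul, Function.comp_def] using
      (hlim.comp fun u => t + ε * u).mono hT

theorem MatrixConvexOn.isUniformLimitOfJets {n : ℕ} {α : ℝ} {f : ℝ → ℝ}
    (hconv : MatrixConvexOn n (Ico 0 α) f) (hcont : ContinuousOn f (Ico 0 α)) (h0 : f 0 ≤ 0)
    {a b : ℝ} (ha : 0 < a) (hab : a ≤ b) (hb : b < α) :
    IsUniformLimitOfJets (fun d => ∀ x : Fin n → ℝ, 0 ≤ hankelForm d x) (fun t => f t / t)
      (Icc a b) := by
  obtain ⟨β, hbβ, hβα⟩ := exists_between hb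
  choose F hsmooth hFconv hF0 hFf using fun k : ℕ =>
    hconv.exists_smooth_approx hcont h0 (ha.le.trans (hab.trans hbβ.le)) hβα
      (Nat.one_div_pos_of_nat (α := ℝ) (n := k))
  refine ⟨fun k => quotDeriv (F k), fun k l s hs =>
    hasDerivAt_quotDeriv (hsmooth k) l (ha.trans_le hs.1).ne', fun k s hs x =>
    hankelForm_quotDeriv_nonneg (hsmooth k) (hF0 k) (fun t ht y =>
      (hFconv k).hankelForm_iteratedDeriv_nonneg (Ico_mem_nhds ht.1 ht.2)
        (contDiff_infty.1 (hsmooth k) _) y)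
      ⟨ha.trans_le hs.1, hs.2.trans_lt hbβ⟩ x, ?_⟩
  rw [Metric.tendstoUniformlyOn_iff]
  intro κ hκ
  filter_upwards [(tendsto_one_div_add_atTop_nhds_zero_nat (𝕜 := ℝ)).eventually_lt_const
    (mul_pos hκ ha)] with k hk s hs
  have hs0 : 0 < s := ha.trans_le hs.1
  rw [dist_comm, Real.dist_eq, quotDeriv, ← sub_div, abs_div, abs_of_pos hs0, div_lt_iff₀ hs0]
  calc |F k s - f s| ≤ 1 / (k + 1) := hFf k s ⟨hs0.le, hs.2.trans hbβ.le⟩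
    _ < κ * a := hk
    _ ≤ κ * s := by gcongr; exact hs.1

end JetLimits

section WeakInequality

open Polynomial

variable {ι : Type*} [Fintype ι] {a b : ℝ}

/-- The formal adjoint of the differential operator `∑ i, w i • D ^ e i`, applied to the polynomial
`W`. -/
def formalAdjoint (w : ι → ℝ) (e : ι → ℕ) (W : ℝ[X]) (u : ℝ) : ℝ :=
  ∑ i, w i * ((-1) ^ e i * (derivative^[e i] W).eval u)

lemma continuous_formalAdjoint (w : ι → ℝ) (e : ι → ℕ) (W : ℝ[X]) :
    Continuous (formalAdjoint w e W) := by
  unfold formalAdjoint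
  fun_prop

lemma integral_jet_mul_polynomial {y : ℕ → ℝ → ℝ} (hy : IsJetOn y (uIcc a b)) (l : ℕ) (W : ℝ[X])
    (hW : ∀ m < l, (derivative^[m] W).eval a = 0 ∧ (derivative^[m] W).eval b = 0) :
    ∫ u in a..b, y l u * W.eval u
      = (-1) ^ l * ∫ u in a..b, y 0 u * (derivative^[l] W).eval u := by
  induction l generalizing W with
  | zero => simp
  | succ l ih =>
    have hparts := intervalIntegral.integral_mul_deriv_eq_deriv_mul (hy l)
      (fun u _ => W.hasDerivAt u) (hy.continuousOn (l + 1)).intervalIntegrable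
      (W.derivative.continuous.intervalIntegrable _ _)
    obtain ⟨hWa, hWb⟩ := hW 0 l.succ_pos
    simp only [Function.iterate_zero, id] at hWa hWb
    rw [hWa, hWb, ih (derivative W) fun m hm => hW (m + 1) (Nat.succ_lt_succ hm)] at hparts
    rw [Function.iterate_succ_apply, pow_succ]
    linarith

lemma integral_sum_jet_mul_polynomial {y : ℕ → ℝ → ℝ} (hy : IsJetOn y (uIcc a b)) (w : ι → ℝ)
    (e : ι → ℕ) (W : ℝ[X]) (hW : ∀ i, ∀ m < e i, (derivative^[m] W).eval a = 0 ∧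
      (derivative^[m] W).eval b = 0) :
    ∫ u in a..b, (∑ i, w i * y (e i) u) * W.eval u
      = ∫ u in a..b, y 0 u * formalAdjoint w e W u := by
  simp only [formalAdjoint, Finset.mul_sum, Finset.sum_mul, mul_assoc, mul_left_comm (y 0 _)]
  rw [intervalIntegral.integral_finsetSum, intervalIntegral.integral_finsetSum]
  · simp only [intervalIntegral.integral_const_mul, integral_jet_mul_polynomial hy _ W (hW _)]
  · exact fun i _ => ContinuousOn.intervalIntegrable <| continuousOn_const.mul <|
      continuousOn_const.mul <| (hy.continuousOn 0).mul (Polynomial.continuous _).continuousOn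
  · exact fun i _ => ContinuousOn.intervalIntegrable <| continuousOn_const.mul <|
      (hy.continuousOn _).mul W.continuous.continuousOn

theorem IsUniformLimitOfJets.integral_mul_formalAdjoint_nonneg {g : ℝ → ℝ} {w : ι → ℝ} {e : ι → ℕ}
    (h : IsUniformLimitOfJets (fun d => 0 ≤ ∑ i, w i * d (e i)) g (Icc a b)) (hab : a ≤ b)
    {W : ℝ[X]} (hW : ∀ i, ∀ m < e i, (derivative^[m] W).eval a = 0 ∧ (derivative^[m] W).eval b = 0)
    (hW0 : ∀ u ∈ Icc a b, 0 ≤ W.eval u) :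
    0 ≤ ∫ u in a..b, g u * formalAdjoint w e W u := by
  obtain ⟨y, hy, hpos, hlim⟩ := h
  rw [← uIcc_of_le hab] at hy hlim
  have huniform : TendstoUniformlyOn (fun k u => y k 0 u * formalAdjoint w e W u)
      (fun u => g u * formalAdjoint w e W u) atTop (uIcc a b) := by
    rw [← tendstoLocallyUniformlyOn_iff_tendstoUniformlyOn_of_compact isCompact_uIcc] at hlim ⊢
    have hK := (continuous_formalAdjoint w e W).continuousOn (s := uIcc a b)
    have hconst : TendstoLocallyUniformlyOn (fun _ : ℕ => formalAdjoint w e W)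
        (formalAdjoint w e W) atTop (uIcc a b) := fun _ hv _ _ =>
      ⟨_, self_mem_nhdsWithin, .of_forall fun _ _ _ => refl_mem_uniformity hv⟩
    exact hlim.mul₀ hconst (hlim.continuousOn (.of_forall fun k => (hy k).continuousOn 0)) hK
  have hintegral : Tendsto (fun k => ∫ u in a..b, y k 0 u * formalAdjoint w e W u) atTop
      (𝓝 (∫ u in a..b, g u * formalAdjoint w e W u)) :=
    huniform.tendsto_intervalIntegral_of_continuousOn <| .of_forall fun k =>
      ((hy k).continuousOn 0).mul (continuous_formalAdjoint w e W).continuousOn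
  refine ge_of_tendsto' hintegral fun k => ?_
  rw [← integral_sum_jet_mul_polynomial (hy k) w e W hW]
  exact intervalIntegral.integral_nonneg hab fun u hu => mul_nonneg (hpos k u hu) (hW0 u hu)

/-- A polynomial that is positive on `(1, 2)` and vanishes to order `m` at `1` and at `2`. -/
def testPoly (m : ℕ) : ℝ[X] := ((X - C 1) * (C 2 - X)) ^ m

lemma iterate_derivative_testPoly_eval {m l : ℕ} (h : l < m) :
    (derivative^[l] (testPoly m)).eval 1 = 0 ∧ (derivative^[l] (testPoly m)).eval 2 = 0 := by
  obtain ⟨q, hq⟩ := (dvd_pow_self ((X - C 1) * (C 2 - X) : ℝ[X]) (Nat.sub_ne_zero_of_lt h)).trans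
    (pow_sub_dvd_iterate_derivative_pow _ m l)
  rw [testPoly, hq]
  simp

lemma testPoly_eval_pos (m : ℕ) {u : ℝ} (hu : u ∈ Ioo (1 : ℝ) 2) : 0 < (testPoly m).eval u := by
  simp only [testPoly, eval_pow, eval_mul, eval_sub, eval_X, eval_C]
  exact pow_pos (mul_pos (sub_pos.2 hu.1) (sub_pos.2 hu.2)) m

lemma testPoly_eval_nonneg (m : ℕ) {u : ℝ} (hu : u ∈ Icc (1 : ℝ) 2) :
    0 ≤ (testPoly m).eval u := by
  simp only [testPoly, eval_pow, eval_mul, eval_sub, eval_X, eval_C]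
  exact pow_nonneg (mul_nonneg (sub_nonneg.2 hu.1) (sub_nonneg.2 hu.2)) m

lemma integral_testPoly_pos (m : ℕ) : 0 < ∫ u in (1 : ℝ)..2, (testPoly m).eval u :=
  intervalIntegral.intervalIntegral_pos_of_pos_on ((testPoly m).continuous.intervalIntegrable _ _)
    (fun _ hu => testPoly_eval_pos m hu) one_lt_two

end WeakInequality

section PointwiseInequality

open Polynomial

lemma isLittleO_integral_rescale_mul {r : ℝ → ℝ} {t : ℝ} {N : ℕ}
    (hr : r =o[𝓝[>] t] fun s => (s - t) ^ N) {K : ℝ → ℝ → ℝ}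
    (hK : Continuous (Function.uncurry K)) :
    (fun ε => ∫ u in (1 : ℝ)..2, r (t + ε * u) * K ε u) =o[𝓝[>] 0] fun ε => ε ^ N := by
  obtain ⟨C, hC⟩ := (isCompact_Icc.prod isCompact_Icc).exists_bound_of_continuousOn
    (hK.continuousOn (s := Icc (0 : ℝ) 1 ×ˢ Icc (1 : ℝ) 2))
  have hC0 : 0 ≤ C := (norm_nonneg _).trans (hC (0, 1) (by simp))
  refine IsLittleO.of_bound fun κ hκ => ?_
  set κ' := κ / (2 ^ N * C + 1)
  have hκ' : κ' * (2 ^ N * C) ≤ κ := by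
    rw [div_mul_eq_mul_div, div_le_iff₀ (by positivity)]
    linarith
  obtain ⟨ρ, hρ, hrρ⟩ := mem_nhdsGT_iff_exists_Ioo_subset.1
    (hr.bound (show 0 < κ' by positivity))
  filter_upwards [Ioc_mem_nhdsGT one_pos, Ioo_mem_nhdsGT (half_pos (sub_pos.2 hρ))]
    with ε hε hερ
  have hε0 : 0 ≤ ε := hε.1.le
  have hbound : ∀ u ∈ uIoc (1 : ℝ) 2, ‖r (t + ε * u) * K ε u‖ ≤ κ * ε ^ N := by
    intro u hu
    rw [uIoc_of_le one_le_two] at hu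
    have hεu : 0 < ε * u := mul_pos hε.1 (by linarith [hu.1])
    have hεu2 : ε * u ≤ 2 * ε := by nlinarith [hu.2]
    have hru : ‖r (t + ε * u)‖ ≤ κ' * ‖(t + ε * u - t) ^ N‖ :=
      hrρ ⟨by linarith, by linarith [hερ.2]⟩
    rw [add_sub_cancel_left, Real.norm_of_nonneg (by positivity : 0 ≤ (ε * u) ^ N)] at hru
    calc ‖r (t + ε * u) * K ε u‖ ≤ κ' * (2 * ε) ^ N * C := by
          rw [norm_mul]
          exact mul_le_mul (hru.trans (by gcongr)) (hC (ε, u) ⟨⟨hε.1.le, hε.2⟩, hu.1.le, hu.2⟩)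
            (norm_nonneg _) (by positivity)
      _ = κ' * (2 ^ N * C) * ε ^ N := by ring
      _ ≤ κ * ε ^ N := by gcongr
  rw [Real.norm_of_nonneg (by positivity : 0 ≤ ε ^ N)]
  simpa [abs_of_pos, show (2 : ℝ) - 1 = 1 by norm_num] using
    intervalIntegral.norm_integral_le_of_norm_le_const hbound

variable {ι : Type*} [Fintype ι]

/-- The kernel against which the pairing of `g (t + ε * u)` is, up to the factor `ε ^ N`, the
pairing of `testPoly N` with the derivatives `∑ i, w i * g^(e i)` at `t + ε * u`. -/
def rescaledKernel (w : ι → ℝ) (e : ι → ℕ) (N : ℕ) (ε : ℝ) : ℝ → ℝ :=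
  formalAdjoint (fun i => w i * ε ^ (N - e i)) e (testPoly N)

lemma continuous_uncurry_rescaledKernel (w : ι → ℝ) (e : ι → ℕ) (N : ℕ) :
    Continuous (Function.uncurry (rescaledKernel w e N)) := by
  unfold Function.uncurry rescaledKernel formalAdjoint
  fun_prop

variable {w : ι → ℝ} {e : ι → ℕ} {N : ℕ}

lemma integral_polynomial_mul_rescaledKernel (he : ∀ i, e i ≤ N) (p : ℝ[X]) (ε : ℝ) :
    ∫ u in (1 : ℝ)..2, p.eval (ε * u) * rescaledKernel w e N ε u
      = ε ^ N * ∫ u in (1 : ℝ)..2,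
        (∑ i, w i * (derivative^[e i] p).eval (ε * u)) * (testPoly N).eval u := by
  have hjet := (isJetOn_iterate_derivative p univ).rescale (t := 0) (ε := ε)
    (mapsTo_univ _ (uIcc 1 2))
  have hparts := integral_sum_jet_mul_polynomial hjet (fun i => w i * ε ^ (N - e i)) e (testPoly N)
    fun i m hm => iterate_derivative_testPoly_eval (hm.trans_le (he i))
  have hpow (i : ι) (z : ℝ) : w i * ε ^ (N - e i) * (ε ^ e i * z) = ε ^ N * (w i * z) := by
    rw [← Nat.sub_add_cancel (he i), pow_add, Nat.add_sub_cancel]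
    ring
  simp only [zero_add, pow_zero, one_mul, hpow, ← Finset.mul_sum, mul_assoc,
    intervalIntegral.integral_const_mul, Function.iterate_zero, id] at hparts
  exact hparts.symm

lemma continuous_integral_sum_derivative_mul (p : ℝ[X]) :
    Continuous fun ε : ℝ => ∫ u in (1 : ℝ)..2,
      (∑ i, w i * (derivative^[e i] p).eval (ε * u)) * (testPoly N).eval u := by
  refine intervalIntegral.continuous_parametric_intervalIntegral_of_continuous' ?_ 1 2
  unfold Function.uncurry
  fun_prop

lemma IsUniformLimitOfJets.integral_mul_rescaledKernel_nonneg {g : ℝ → ℝ} {t ε : ℝ} (hε : 0 < ε)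
    (h : IsUniformLimitOfJets (fun d => 0 ≤ ∑ i, w i * d (e i)) g (Icc (t + ε) (t + 2 * ε)))
    (he : ∀ i, e i ≤ N) :
    0 ≤ ∫ u in (1 : ℝ)..2, g (t + ε * u) * rescaledKernel w e N ε u := by
  have hmaps : MapsTo (fun u => t + ε * u) (Icc 1 2) (Icc (t + ε) (t + 2 * ε)) := fun u hu =>
    ⟨by nlinarith [hu.1], by nlinarith [hu.2]⟩
  refine ((h.rescale hε.ne' hmaps).mono fun d hd => ?_).integral_mul_formalAdjoint_nonneg
    one_le_two (fun i m hm => iterate_derivative_testPoly_eval (hm.trans_le (he i)))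
    fun u hu => testPoly_eval_nonneg N hu
  refine (mul_nonneg (pow_pos hε N).le hd).trans_eq ?_
  rw [Finset.mul_sum]
  refine Finset.sum_congr rfl fun i _ => ?_
  rw [pow_sub₀ _ hε.ne' (he i)]
  field_simp

theorem sum_derivative_nonneg_of_isUniformLimitOfJets {g : ℝ → ℝ} {t b : ℝ} (htb : t < b)
    (h : ∀ a' b', t < a' → a' ≤ b' → b' < b →
      IsUniformLimitOfJets (fun d => 0 ≤ ∑ i, w i * d (e i)) g (Icc a' b'))
    (he : ∀ i, e i ≤ N) {p : ℝ[X]}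
    (hp : (fun s => g s - p.eval (s - t)) =o[𝓝[>] t] fun s => (s - t) ^ N) :
    0 ≤ ∑ i, w i * (derivative^[e i] p).eval 0 := by
  set Λ : ℝ → ℝ := fun ε => ∫ u in (1 : ℝ)..2,
    (∑ i, w i * (derivative^[e i] p).eval (ε * u)) * (testPoly N).eval u
  have hrem := isLittleO_integral_rescale_mul hp (continuous_uncurry_rescaledKernel w e N)
  have hΛ : Tendsto Λ (𝓝[>] 0) (𝓝 (Λ 0)) :=
    ((continuous_integral_sum_derivative_mul p).tendsto 0).mono_left nhdsWithin_le_nhds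
  have hΛ0 : 0 ≤ Λ 0 + 0 := by
    refine ge_of_tendsto (hΛ.add hrem.tendsto_div_nhds_zero) ?_
    filter_upwards [Ioo_mem_nhdsGT (half_pos (sub_pos.2 htb))] with ε hε
    have hε0 : 0 < ε := hε.1
    have hlim := h (t + ε) (t + 2 * ε) (by linarith) (by linarith) (by linarith [hε.2])
    have hg : ContinuousOn (fun u => g (t + ε * u)) (uIcc 1 2) := by
      rw [uIcc_of_le one_le_two]
      exact hlim.continuousOn.comp (by fun_prop) fun u hu =>
        ⟨by nlinarith [hu.1], by nlinarith [hu.2]⟩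
    have hK : Continuous (rescaledKernel w e N ε) := continuous_formalAdjoint _ _ _
    have hsplit : ∫ u in (1 : ℝ)..2, g (t + ε * u) * rescaledKernel w e N ε u
        = ε ^ N * Λ ε + ∫ u in (1 : ℝ)..2,
          (g (t + ε * u) - p.eval (t + ε * u - t)) * rescaledKernel w e N ε u := by
      have hint1 : IntervalIntegrable (fun u => g (t + ε * u) * rescaledKernel w e N ε u)
          MeasureTheory.volume 1 2 := (hg.mul hK.continuousOn).intervalIntegrable
      have hint2 : IntervalIntegrable (fun u => p.eval (ε * u) * rescaledKernel w e N ε u)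
          MeasureTheory.volume 1 2 := Continuous.intervalIntegrable (by fun_prop) _ _
      simp only [sub_mul, add_sub_cancel_left]
      rw [intervalIntegral.integral_sub hint1 hint2, integral_polynomial_mul_rescaledKernel he,
        add_sub_cancel]
    have hnonneg := hlim.integral_mul_rescaledKernel_nonneg hε0 he
    rw [hsplit] at hnonneg
    have hpow : 0 < ε ^ N := pow_pos hε0 N
    rw [← mul_div_cancel_left₀ (Λ ε) hpow.ne', ← add_div]
    exact div_nonneg hnonneg hpow.le
  simp only [Λ, zero_mul, add_zero, intervalIntegral.integral_const_mul] at hΛ0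
  exact nonneg_of_mul_nonneg_left hΛ0 (integral_testPoly_pos N)

end PointwiseInequality

section HankelMatrix

open Polynomial

lemma TimesDifferentiableWithinAt.derivWithin {m : ℕ} {G : ℝ → ℝ} {S : Set ℝ} {t : ℝ}
    (h : TimesDifferentiableWithinAt (m + 1) G S t) :
    TimesDifferentiableWithinAt m (derivWithin G S) S t := by
  intro k hk
  have hk' := h (k + 1) (by omega)
  simp only [iteratedDerivWithin_succ'] at hk'
  exact ⟨hk'.1, fun hkm => hk'.2 (by omega)⟩

lemma TimesDifferentiableWithinAt.isLittleO_taylorWithinEval {m : ℕ} {G : ℝ → ℝ} {S : Set ℝ}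
    {t : ℝ} (h : TimesDifferentiableWithinAt (m + 1) G S t) (hS : Convex ℝ S) (ht : t ∈ S) :
    (fun s => G s - taylorWithinEval G (m + 1) S t s) =o[𝓝[S] t] fun s => (s - t) ^ (m + 1) := by
  have hG : DifferentiableWithinAt ℝ G S t := by simpa using (h 0 m.succ_pos).1
  induction m generalizing G with
  | zero =>
    refine (hasDerivWithinAt_iff_isLittleO.1 hG.hasDerivWithinAt).congr (fun s => ?_) fun s => ?_
    · simp only [smul_eq_mul, zero_add, taylorWithinEval_succ, taylor_within_zero_eval,
        CharP.cast_eq_zero, Nat.factorial_zero, Nat.cast_one, mul_one, inv_one, pow_one, one_mul,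
        iteratedDerivWithin_one]
      ring
    · simp
  | succ m ih =>
    have hderiv : ∀ᶠ s in 𝓝[S] t, DifferentiableWithinAt ℝ G S s := by
      simpa using (h 0 (by omega)).2 (by omega)
    obtain ⟨ρ, hρ, hρG⟩ := Metric.mem_nhdsWithin_iff.1 hderiv
    have hlocal : 𝓝[S ∩ Metric.ball t ρ] t = 𝓝[S] t :=
      nhdsWithin_inter_of_mem' (mem_nhdsWithin_of_mem_nhds (Metric.ball_mem_nhds t hρ))
    have hrem := (hS.inter (convex_ball t ρ)).isLittleO_pow_succ_real (n := m + 1)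
      (f := fun s => G s - taylorWithinEval G (m + 2) S t s) ⟨ht, Metric.mem_ball_self hρ⟩
      (fun s hs => ((hρG hs.symm).hasDerivWithinAt.mono inter_subset_left).sub
        (hasDerivAt_taylorWithinEval_succ G (m + 1)).hasDerivWithinAt)
    rw [hlocal] at hrem
    simpa using hrem (ih h.derivWithin (by simpa using (h.derivWithin 0 m.succ_pos).1))

lemma iterate_derivative_sum_factorial_eval_zero (d : ℕ → ℝ) {l N : ℕ} (hl : l < N) :
    (derivative^[l] (∑ k ∈ Finset.range N, C (d k / k.factorial) * X ^ k)).eval 0 = d l := by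
  rw [← coeff_zero_eq_eval_zero, coeff_iterate_derivative, zero_add, Nat.descFactorial_self]
  simp only [finsetSum_coeff, coeff_C_mul_X_pow, Finset.sum_ite_eq, Finset.mem_range, hl, if_true,
    nsmul_eq_mul]
  field_simp

theorem sum_iteratedDerivWithin_nonneg_of_isUniformLimitOfJets {ι : Type*} [Fintype ι] {w : ι → ℝ}
    {e : ι → ℕ} {N : ℕ} (he : ∀ i, e i ≤ N + 1) {g : ℝ → ℝ} {S : Set ℝ} {t b : ℝ}
    (hS : Convex ℝ S) (ht : t ∈ S) (htb : t < b) (hbS : Ioo t b ⊆ S)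
    (h : ∀ a' b', t < a' → a' ≤ b' → b' < b →
      IsUniformLimitOfJets (fun d => 0 ≤ ∑ i, w i * d (e i)) g (Icc a' b'))
    (hg : TimesDifferentiableWithinAt (N + 1) g S t) :
    0 ≤ ∑ i, w i * iteratedDerivWithin (e i) g S t := by
  have hle : 𝓝[>] t ≤ 𝓝[S] t := by
    rw [← nhdsWithin_Ioo_eq_nhdsGT htb]
    exact nhdsWithin_mono t hbS
  set p : ℝ[X] := ∑ k ∈ Finset.range (N + 2), C (iteratedDerivWithin k g S t / k.factorial) * X ^ k
  have hp : (fun s => g s - p.eval (s - t)) =o[𝓝[>] t] fun s => (s - t) ^ (N + 1) := by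
    refine ((hg.isLittleO_taylorWithinEval hS ht).mono hle).congr_left fun s => ?_
    rw [taylor_within_apply, eval_finsetSum]
    congr 1
    refine Finset.sum_congr rfl fun k _ => ?_
    simp only [eval_mul, eval_C, eval_pow, eval_X, smul_eq_mul]
    ring
  have hpos := sum_derivative_nonneg_of_isUniformLimitOfJets htb h he hp
  rwa [Finset.sum_congr rfl fun i _ => congrArg (w i * ·)
    (iterate_derivative_sum_factorial_eval_zero _ (Nat.lt_succ_of_le (he i)))] at hpos

variable {n : ℕ} {α : ℝ} {f G : ℝ → ℝ}

lemma hankelForm_eq_sum_mul (d : ℕ → ℝ) (x : Fin n → ℝ) :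
    hankelForm d x = ∑ p : Fin n × Fin n,
      x p.1 * x p.2 / (p.1 + p.2 + 2 : ℕ).factorial * d (p.1 + p.2 + 1) :=
  Finset.sum_congr rfl fun _ _ => mul_div_left_comm _ _ _ |>.trans (mul_comm _ _)

lemma hankelK_posSemidef_iff_hankelForm (G : ℝ → ℝ) (S : Set ℝ) (t : ℝ) :
    (hankelK n G S t).PosSemidef ↔
      ∀ x : Fin n → ℝ, 0 ≤ hankelForm (fun l => iteratedDerivWithin (l + 1) G S t) x := by
  have hherm : (hankelK n G S t).IsHermitian := by
    ext i j
    simp [hankelK, add_comm]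
  rw [Matrix.posSemidef_iff_dotProduct_mulVec, and_iff_right hherm]
  refine forall_congr' fun x => iff_of_eq (congrArg (0 ≤ ·) ?_)
  simp only [dotProduct, Matrix.mulVec, hankelK, Matrix.of_apply, Finset.mul_sum, star_trivial,
    hankelForm, Fintype.sum_prod_type]
  refine Finset.sum_congr rfl fun i _ => Finset.sum_congr rfl fun j _ => ?_
  rw [show (i + 1 + (j + 1) : ℕ) = i + j + 2 by ring]
  ring

theorem MatrixConvexOn.hankelK_posSemidef (hconv : MatrixConvexOn n (Ico 0 α) f)
    (hcont : ContinuousOn f (Ico 0 α)) (h0 : f 0 ≤ 0) (hn : 1 ≤ n)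
    (hG : ∀ t ∈ Ioo 0 α, HasDerivAt G (f t / t) t) {t : ℝ} (ht : t ∈ Ico 0 α)
    (hd : TimesDifferentiableWithinAt (2 * n) G (Ico 0 α) t) :
    (hankelK n G (Ico 0 α) t).PosSemidef := by
  obtain ⟨n, rfl⟩ := Nat.exists_eq_add_of_le' hn
  have hderiv : EqOn (fun s => f s / s) (derivWithin G (Ico 0 α)) (Ioo 0 α) := fun s hs =>
    ((hG s hs).hasDerivWithinAt.derivWithin
      (uniqueDiffOn_Ico 0 α s (Ioo_subset_Ico_self hs))).symm
  refine (hankelK_posSemidef_iff_hankelForm _ _ _).2 fun x => ?_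
  simp only [iteratedDerivWithin_succ']
  rw [hankelForm_eq_sum_mul]
  refine sum_iteratedDerivWithin_nonneg_of_isUniformLimitOfJets (N := 2 * n) (b := α)
    (fun p => by omega) (convex_Ico 0 α) ht ht.2 (fun s hs => ⟨ht.1.trans hs.1.le, hs.2⟩)
    (fun a b hta hab hb => ?_) hd.derivWithin
  have ha : 0 < a := ht.1.trans_lt hta
  refine ((hconv.isUniformLimitOfJets hcont h0 ha hab hb).congr ?_).mono
    fun d hd => hankelForm_eq_sum_mul d x ▸ hd x
  exact hderiv.mono (Icc_subset_Ioo ha hb)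

end HankelMatrix

section OrderTwo

lemma MatrixConvexOn.convexOn {n : ℕ} [NeZero n] {I : Set ℝ} {f : ℝ → ℝ}
    (h : MatrixConvexOn n I f) (hI : Convex ℝ I) : ConvexOn ℝ I f := by
  refine ⟨hI, fun x hx y hy a b ha hb hab => ?_⟩
  obtain rfl : b = 1 - a := by linarith
  let scalar : ℝ → Matrix (Fin n) (Fin n) ℂ := algebraMap ℝ _
  have hherm (r : ℝ) : (scalar r).IsHermitian :=
    IsSelfAdjoint.algebraMap (Matrix (Fin n) (Fin n) ℂ) (IsSelfAdjoint.all r)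
  have hspec (r : ℝ) (hr : r ∈ I) : spectrum ℝ (scalar r) ⊆ I := by
    simpa only [scalar, spectrum.scalar_eq, singleton_subset_iff] using hr
  have hcomb : a • scalar x + (1 - a) • scalar y = scalar (a • x + (1 - a) • y) := by
    simp only [scalar, Algebra.algebraMap_eq_smul_one, smul_eq_mul]
    module
  have hquad (r : ℝ) :
      quadForm (cfc f (scalar r)) 1 = f r * quadForm (1 : Matrix (Fin n) (Fin n) ℂ) 1 := by
    rw [cfc_algebraMap, Algebra.algebraMap_eq_smul_one, quadForm_smul]
  have hconv := matrixConvexOn_iff_quadForm.1 h _ _ (hherm x) (hherm y) (hspec x hx) (hspec y hy)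
    a ⟨ha, by linarith⟩ 1
  rw [hcomb, hquad, hquad, hquad] at hconv
  have hpos : 0 < quadForm (1 : Matrix (Fin n) (Fin n) ℂ) 1 := by
    simp [quadForm, NeZero.pos n]
  refine le_of_mul_le_mul_right ?_ hpos
  simp only [smul_eq_mul, add_mul, mul_assoc] at hconv ⊢
  exact hconv

lemma convexOn_of_tendsto {X : Type*} {φ : Filter X} [φ.NeBot] {F : X → ℝ → ℝ} {g : ℝ → ℝ}
    {S : Set ℝ} (hS : Convex ℝ S) (hF : ∀ᶠ k in φ, ConvexOn ℝ S (F k))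
    (hlim : ∀ s ∈ S, Tendsto (fun k => F k s) φ (𝓝 (g s))) : ConvexOn ℝ S g := by
  refine ⟨hS, fun x hx y hy a b ha hb hab => ?_⟩
  exact le_of_tendsto_of_tendsto (hlim _ (hS hx hy ha hb hab))
    (((hlim x hx).const_smul a).add ((hlim y hy).const_smul b))
    (hF.mono fun k hk => hk.2 hx hy ha hb hab)

lemma convexOn_Ioo_of_forall_Icc {g : ℝ → ℝ} {a b : ℝ}
    (h : ∀ a' b', a < a' → a' ≤ b' → b' < b → ConvexOn ℝ (Icc a' b') g) :
    ConvexOn ℝ (Ioo a b) g := by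
  refine ⟨convex_Ioo a b, fun x hx y hy => ?_⟩
  exact (h (min x y) (max x y) (lt_min hx.1 hy.1) min_le_max (max_lt hx.2 hy.2)).2
    ⟨min_le_left x y, le_max_left x y⟩ ⟨min_le_right x y, le_max_right x y⟩

lemma IsJetOn.convexOn_increment {y : ℕ → ℝ → ℝ} {a b : ℝ} (hy : IsJetOn y (Icc a b))
    (h3 : ∀ s ∈ Icc a b, 0 ≤ y 3 s) {h : ℝ} (hh : 0 ≤ h) :
    ConvexOn ℝ (Icc a (b - h)) fun s => y 0 (s + h) - y 0 s := by
  have hmem {s : ℝ} (hs : s ∈ Icc a (b - h)) : s ∈ Icc a b ∧ s + h ∈ Icc a b :=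
    ⟨⟨hs.1, by linarith [hs.2]⟩, by linarith [hs.1], by linarith [hs.2]⟩
  have hderiv (l : ℕ) {s : ℝ} (hs : s ∈ Icc a (b - h)) :
      HasDerivAt (fun s => y l (s + h) - y l s) (y (l + 1) (s + h) - y (l + 1) s) s :=
    ((hy l _ (hmem hs).2).comp_add_const s h).sub (hy l s (hmem hs).1)
  have hmono : MonotoneOn (y 2) (Icc a b) :=
    monotoneOn_of_hasDerivWithinAt_nonneg (convex_Icc a b) (hy.continuousOn 2)
      (fun s hs => (hy 2 s (interior_subset hs)).hasDerivWithinAt)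
      fun s hs => h3 s (interior_subset hs)
  refine convexOn_of_hasDerivWithinAt2_nonneg (convex_Icc a (b - h))
    (fun s hs => (hderiv 0 hs).continuousAt.continuousWithinAt)
    (fun s hs => (hderiv 0 (interior_subset hs)).hasDerivWithinAt)
    (fun s hs => (hderiv 1 (interior_subset hs)).hasDerivWithinAt) fun s hs => ?_
  obtain ⟨hs, hsh⟩ := hmem (interior_subset hs)
  exact sub_nonneg.2 (hmono hs hsh (le_add_of_nonneg_right hh))

variable {g r : ℝ → ℝ} {a b : ℝ}

lemma IsUniformLimitOfJets.convexOn_increment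
    (hg : IsUniformLimitOfJets (fun d => 0 ≤ d 3) g (Icc a b)) {h : ℝ} (hh : 0 ≤ h) :
    ConvexOn ℝ (Icc a (b - h)) fun s => g (s + h) - g s := by
  obtain ⟨y, hy, h3, hlim⟩ := hg
  refine convexOn_of_tendsto (φ := atTop) (convex_Icc a (b - h))
    (.of_forall fun k => (hy k).convexOn_increment (h3 k) hh) fun s hs => ?_
  exact (hlim.tendsto_at ⟨by linarith [hs.1], by linarith [hs.2]⟩).sub
    (hlim.tendsto_at ⟨hs.1, by linarith [hs.2]⟩)

lemma tendsto_forward_quotient {s : ℝ} (hr : HasDerivWithinAt g (r s) (Ioi s) s) :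
    Tendsto (fun h => h⁻¹ • (g (s + h) - g s)) (𝓝[>] 0) (𝓝 (r s)) := by
  have hslope := (hasDerivWithinAt_iff_tendsto_slope' self_notMem_Ioi).1 hr
  have hshift : Tendsto (fun h => s + h) (𝓝[>] 0) (𝓝[>] s) := by
    simpa using tendsto_map (f := fun h => s + h) (x := 𝓝[>] (0 : ℝ))
  simpa [Function.comp_def, slope] using hslope.comp hshift

lemma convexOn_rightDeriv_of_convexOn_increment
    (hr : ∀ s ∈ Ioo a b, HasDerivWithinAt g (r s) (Ioi s) s)
    (hinc : ∀ a' b' h, a < a' → a' ≤ b' → 0 ≤ h → b' + h < b →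
      ConvexOn ℝ (Icc a' b') fun s => g (s + h) - g s) :
    ConvexOn ℝ (Ioo a b) r := by
  refine convexOn_Ioo_of_forall_Icc fun a' b' ha hab hb => ?_
  refine convexOn_of_tendsto (convex_Icc a' b') ?_ fun s hs =>
    tendsto_forward_quotient (hr s ⟨ha.trans_le hs.1, hs.2.trans_lt hb⟩)
  filter_upwards [Ioo_mem_nhdsGT (sub_pos.2 hb)] with h hh
  exact (hinc a' b' h ha hab hh.1.le (by linarith [hh.2])).smul (inv_nonneg.2 hh.1.le)

lemma hasDerivAt_of_hasDerivWithinAt_Ioi (hg : ContinuousOn g (Ioo a b))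
    (hr : ∀ s ∈ Ioo a b, HasDerivWithinAt g (r s) (Ioi s) s) (hrc : ContinuousOn r (Ioo a b))
    {s : ℝ} (hs : s ∈ Ioo a b) : HasDerivAt g (r s) s := by
  have hprim := intervalIntegral.integral_hasDerivAt_right (f := r) (a := s) (b := s)
    IntervalIntegrable.refl (hrc.stronglyMeasurableAtFilter isOpen_Ioo s hs)
    (hrc.continuousAt (Ioo_mem_nhds hs.1 hs.2))
  refine (hprim.const_add (g s)).congr_of_eventuallyEq ?_
  filter_upwards [Ioo_mem_nhds hs.1 hs.2] with q hq
  have hsub : uIcc s q ⊆ Ioo a b := ordConnected_Ioo.uIcc_subset hs hq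
  rw [intervalIntegral.integral_eq_sub_of_hasDeriv_right (hg.mono hsub)
    (fun u hu => hr u (hsub (Ioo_subset_Icc_self hu))) (hrc.mono hsub).intervalIntegrable,
    add_sub_cancel]

lemma slope_le_of_convexOn_deriv (hg : ∀ s ∈ Ioo a b, HasDerivAt g (r s) s)
    (hr : ConvexOn ℝ (Ioo a b) r) {p q : ℝ} (hp : p ∈ Ioo a b) (hq : q ∈ Ioo a b) (hpq : p < q) :
    slope g p q ≤ (r p + r q) / 2 := by
  have hqp : 0 < q - p := sub_pos.2 hpq
  set c := (r q - r p) / (q - p)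
  have hchord {s : ℝ} (hs : s ∈ Icc p q) : r s ≤ r p + c * (s - p) := by
    rcases hs.1.eq_or_lt with rfl | hps
    · simp
    · have := hr.secant_mono hp (hr.1.ordConnected.out hp hq hs) hq hps.ne' hpq.ne' hs.2
      rw [div_le_iff₀ (sub_pos.2 hps)] at this
      linarith
  have hderiv {s : ℝ} (hs : s ∈ Icc p q) :
      HasDerivAt (fun s => r p * s + c * ((s - p) ^ 2 / 2) - g s) (r p + c * (s - p) - r s) s := by
    have hsq := (((hasDerivAt_id' s).sub_const p).fun_pow 2).div_const 2
    refine ((((hasDerivAt_id' s).const_mul (r p)).fun_add (hsq.const_mul c)).fun_sub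
      (hg s (hr.1.ordConnected.out hp hq hs))).congr_deriv ?_
    push_cast
    ring
  have hmono : MonotoneOn (fun s => r p * s + c * ((s - p) ^ 2 / 2) - g s) (Icc p q) :=
    monotoneOn_of_hasDerivWithinAt_nonneg (convex_Icc p q)
      (fun s hs => (hderiv hs).continuousAt.continuousWithinAt)
      (fun s hs => (hderiv (interior_subset hs)).hasDerivWithinAt)
      fun s hs => sub_nonneg.2 (hchord (interior_subset hs))
  have hends := hmono ⟨le_rfl, hpq.le⟩ ⟨hpq.le, le_rfl⟩ hpq.le
  have hc : c * (q - p) ^ 2 = (r q - r p) * (q - p) := by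
    simp only [c]
    field_simp
  rw [slope_def_field, div_le_iff₀ hqp]
  simp only [sub_self] at hends
  linarith

lemma dslope_comm (g : ℝ → ℝ) (s t : ℝ) : dslope g s t = dslope g t s := by
  rcases eq_or_ne s t with rfl | hst
  · rfl
  · rw [dslope_of_ne _ hst.symm, dslope_of_ne _ hst, slope_comm]

lemma condPosDef_loewnerMatrix_two {p : Fin 2 → ℝ}
    (h : dslope g (p 0) (p 1) ≤ (deriv g (p 0) + deriv g (p 1)) / 2) :
    CondPosDef (loewnerMatrix g p) := by
  refine ⟨Matrix.IsHermitian.ext fun i j => ?_, fun x hx => ?_⟩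
  · simp [loewnerMatrix, dslope_comm g (p i)]
  have hx1 : x 1 = -x 0 := by
    rw [Fin.sum_univ_two] at hx
    linear_combination hx
  have hform : star x ⬝ᵥ loewnerMatrix g p *ᵥ x
      = (((deriv g (p 0) + deriv g (p 1) - 2 * dslope g (p 0) (p 1)) * Complex.normSq (x 0) : ℝ) :
          ℂ) := by
    simp only [dotProduct, Matrix.mulVec, Fin.sum_univ_two, Pi.star_apply, loewnerMatrix,
      Matrix.of_apply, hx1, dslope_comm g (p 1) (p 0), dslope_same]
    push_cast
    rw [Complex.normSq_eq_conj_mul_self, star_neg, ← starRingEnd_apply]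
    ring
  rw [hform, Complex.ofReal_re]
  exact mul_nonneg (by linarith) (Complex.normSq_nonneg _)

lemma mem_classQ_two_of_convexOn_deriv (hg : ∀ s ∈ Ioo a b, HasDerivAt g (r s) s)
    (hr : ConvexOn ℝ (Ioo a b) r) : g ∈ ClassQ 2 a b := by
  refine ⟨?_, fun p hp => condPosDef_loewnerMatrix_two ?_⟩
  · rw [show (1 : WithTop ℕ∞) = 0 + 1 by simp, contDiffOn_succ_iff_deriv_of_isOpen isOpen_Ioo,
      contDiffOn_zero]
    exact ⟨fun s hs => (hg s hs).differentiableAt.differentiableWithinAt, by simp,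
      (hr.continuousOn isOpen_Ioo).congr fun s hs => (hg s hs).deriv⟩
  rw [(hg _ (hp 0)).deriv, (hg _ (hp 1)).deriv]
  rcases lt_trichotomy (p 0) (p 1) with hlt | heq | hgt
  · rw [dslope_of_ne _ hlt.ne']
    exact slope_le_of_convexOn_deriv hg hr (hp 0) (hp 1) hlt
  · rw [heq, dslope_same, (hg _ (hp 1)).deriv, add_self_div_two]
  · rw [dslope_of_ne _ hgt.ne, slope_comm, add_comm]
    exact slope_le_of_convexOn_deriv hg hr (hp 1) (hp 0) hgt

lemma nonneg_of_hankelForm_two_nonneg {d : ℕ → ℝ} (h : ∀ x : Fin 2 → ℝ, 0 ≤ hankelForm d x) :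
    0 ≤ d 3 := by
  have hform : hankelForm d ![0, 1] = d 3 / (4).factorial := by
    simp [hankelForm, Fintype.sum_prod_type, Fin.sum_univ_two]
  have hpos : (0 : ℝ) < (4).factorial := Nat.cast_pos.2 (Nat.factorial_pos 4)
  simpa only [hform, le_div_iff₀ hpos, zero_mul] using h ![0, 1]

theorem MatrixConvexOn.quotient_mem_classQ_two {α : ℝ} {f : ℝ → ℝ}
    (hconv : MatrixConvexOn 2 (Ico 0 α) f) (hcont : ContinuousOn f (Ico 0 α)) (h0 : f 0 ≤ 0) :
    (fun t => f t / t) ∈ ClassQ 2 0 α := by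
  have hquot : ContinuousOn (fun t => f t / t) (Ioo 0 α) :=
    (hcont.mono Ioo_subset_Ico_self).div continuousOn_id fun s hs => hs.1.ne'
  obtain ⟨r, hr⟩ : ∃ r : ℝ → ℝ,
      ∀ s ∈ Ioo 0 α, HasDerivWithinAt (fun t => f t / t) (r s) (Ioi s) s :=
    ⟨_, fun s hs => ((hconv.convexOn (convex_Ico 0 α)).hasDerivWithinAt_rightDeriv_of_mem_interior
      (by rwa [interior_Ico])).fun_div (hasDerivWithinAt_id s _) hs.1.ne'⟩
  have hinc (a b h : ℝ) (ha : 0 < a) (hab : a ≤ b) (hh : 0 ≤ h) (hb : b + h < α) :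
      ConvexOn ℝ (Icc a b) fun s => f (s + h) / (s + h) - f s / s := by
    have hlim := (hconv.isUniformLimitOfJets hcont h0 ha (by linarith) hb).mono
      fun d hd => nonneg_of_hankelForm_two_nonneg hd
    simpa only [add_sub_cancel_right] using hlim.convexOn_increment hh
  have hrconv := convexOn_rightDeriv_of_convexOn_increment hr hinc
  exact mem_classQ_two_of_convexOn_deriv (fun s => hasDerivAt_of_hasDerivWithinAt_Ioi hquot hr
    (hrconv.continuousOn isOpen_Ioo)) hrconv

end OrderTwo

end

theorem mainTheorem4 (n : ℕ) (hn : 1 ≤ n) (α : ℝ) (hα : 0 < α) (f : ℝ → ℝ)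
    (hcont : ContinuousOn f (Ico 0 α)) (hconv : MatrixConvexOn n (Ico 0 α) f) (h0 : f 0 ≤ 0) :
    (∀ G : ℝ → ℝ, (∀ t ∈ Ioo 0 α, HasDerivAt G (f t / t) t) →
      ∀ t ∈ Ico 0 α, TimesDifferentiableWithinAt (2 * n) G (Ico 0 α) t →
        (hankelK n G (Ico 0 α) t).PosSemidef) ∧
    (n = 2 → (fun t => f t / t) ∈ ClassQ 2 0 α) := by
  refine ⟨fun G hG t ht hd => hconv.hankelK_posSemidef hcont h0 hn hG ht hd, ?_⟩
  rintro rfl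
  exact hconv.quotient_mem_classQ_two hcont h0
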